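/- Two circles are externally tangent if they bound closed discs with disjoint interiors that touch at a point; a line counts as a circle (its disc being a closed half-plane), but two parallel lines do not count as tangent. For pairwise externally tangent circles $A,B,C$, let the \emph{successor} of $(A,B,C)$ be the circle that is externally tangent to all three and lies in the bounded region between them; equivalently, it is the externally tangent circle that is smaller than each of $A,B,C$. Let $C_0$ be a circle with center $c_0$. For a circle $C$ with center $c$ that is externally tangent to $C_0$, let $\alpha(C)$ be the angle of the vector $v(C)=c-c_0$ with the positive $x$-axis (if $C$ is a line, $v(C)$ is the unit normal of $C$ pointing away from $C_0$), and let $\ell^{1/2}(C)=\mathbb{R}\,v(C)^{1/2}$ be the real line spanned by a complex square root of $v(C)$, where $\mathbb{R}^2=\mathbb{C}$. For tangent circles $C,C'$ that are externally tangent to $C_0$, let $s(C,C')$ be the successor of $(C_0,C,C')$. If $C_0,C_1,C_2$ are pairwise externally tangent, let $\mathcal{C}$ be the smallest set of circles that contains $C_1,C_2$ and contains $s(C,C')$ for all tangent $C,C'\in\mathcal{C}$. An \emph{Apollonian curve} for $(C_0,C_1,C_2)$ is a continuous curve $\gamma:[\alpha(C_1),\alpha(C_2)]\to\mathbb{R}^2$,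 defined on the interval of angles (of length less than $\pi$) that faces the gap between the three circles, such that $$\gamma(\alpha(C))-\gamma(\alpha(C'))\in\ell^{1/2}(s(C,C'))\quad\text{for all tangent } C,C'\in\mathcal{C}.$$ Let $C_1,C_2,C_3$ be pairwise externally tangent circles and let $C_0$ be externally tangent to each of them. Let $\gamma_{12},\gamma_{23},\gamma_{31}$ be Apollonian curves for $(C_0,C_1,C_2)$, $(C_0,C_2,C_3)$, $(C_0,C_3,C_1)$ with matching endpoints $$p_1=\gamma_{31}(\alpha(C_1))=\gamma_{12}(\alpha(C_1)),\quad p_2=\gamma_{12}(\alpha(C_2))=\gamma_{23}(\alpha(C_2)),\quad p_3=\gamma_{23}(\alpha(C_3))=\gamma_{31}(\alpha(C_3)).$$ The bounded region $\mathcal{T}$ enclosed by the images of these curves is called an \emph{Apollonian triangle} with vertices $p_1,p_2,p_3$; it is \emph{proper} if $C_0$ is the successor of $(C_1,C_2,C_3)$. \textbf{Lemma.} A proper Apollonian triangle $\mathcal{T}$ with vertices $p_1,p_2,p_3$ has area exactly $\frac47 A(T)$, where $A(T)$ is the area of the Euclidean triangle $T=\triangle p_1p_2p_3$. -/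

import Mathlib

/- The plane `ℝ²` is identified with `ℂ`; areas are Lebesgue measure on `ℂ`.  A circle is given
by its closed disc and a line by one of its two closed half-planes, so that an external tangency
is a tangency of two such closed sets with disjoint interiors. -/

namespace Apollonian

/-- A round closed disc (equivalently, a proper circle). -/
structure RoundDisc where
  center : ℂ
  radius : ℝ
  radius_pos : 0 < radius

/-- A generalized closed disc: a round disc, or the closed half-plane
`{z | d ≤ ⟪u, z⟫}` with unit inner normal `u`. Its boundary is a circle or a line. -/
inductive GenDisc where
  | disc (D : RoundDisc) : GenDisc
  | halfPlane (u : ℂ) (hu : ‖u‖ = 1) (d : ℝ) : GenDisc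

/-- External tangency. Two lines are never externally tangent in the finite plane. -/
def ExternallyTangent : GenDisc → GenDisc → Prop
  | .disc D, .disc E => dist D.center E.center = D.radius + E.radius
  | .disc D, .halfPlane u _ d => inner ℝ u D.center + D.radius = d
  | .halfPlane u _ d, .disc D => inner ℝ u D.center + D.radius = d
  | .halfPlane _ _ _, .halfPlane _ _ _ => False

/-- The curvature: the inverse of the radius, and `0` for a line. -/
noncomputable def GenDisc.curvature : GenDisc → ℝ
  | .disc D => D.radius⁻¹
  | .halfPlane _ _ _ => 0

/-- `S` is smaller than `A` (a line has infinite radius). -/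
def IsSmaller (S : RoundDisc) (A : GenDisc) : Prop :=
  A.curvature < (GenDisc.disc S).curvature

/-- For pairwise externally tangent `A`, `B`, `C`: the circle `S` is their successor, i.e. the
circle that touches all three externally and sits in the bounded gap between them. Among the at
most two circles that touch all three externally it is the one that is smaller than each of
`A`, `B`, `C`. -/
structure IsSuccessor (A B C : GenDisc) (S : RoundDisc) : Prop where
  tangent₁ : ExternallyTangent (.disc S) A
  tangent₂ : ExternallyTangent (.disc S) B
  tangent₃ : ExternallyTangent (.disc S) C
  smaller₁ : IsSmaller S A
  smaller₂ : IsSmaller S B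
  smaller₃ : IsSmaller S C

/-- The smallest set of circles that contains `C₁`, `C₂` and, with any two tangent members
`C`, `C'`, the successor of `(C₀, C, C')`. -/
inductive Family (C₀ : RoundDisc) (C₁ C₂ : GenDisc) : GenDisc → Prop
  | left : Family C₀ C₁ C₂ C₁
  | right : Family C₀ C₁ C₂ C₂
  | succ {C C' : GenDisc} {S : RoundDisc} :
      Family C₀ C₁ C₂ C → Family C₀ C₁ C₂ C' → ExternallyTangent C C' →
      IsSuccessor (.disc C₀) C C' S → Family C₀ C₁ C₂ (.disc S)

/-- The vector from the center of `C₀` to the center of `C`. For a line, whose center is at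
infinity, the unit vector orthogonal to the line and pointing away from `C₀`. -/
noncomputable def centerVec (C₀ : RoundDisc) : GenDisc → ℂ
  | .disc D => D.center - C₀.center
  | .halfPlane u _ _ => u

/-- The angle `α(C)`, modulo `2π`, of the vector from `C₀` to `C` with the positive `x`-axis. -/
noncomputable def angle (C₀ : RoundDisc) (C : GenDisc) : Real.Angle :=
  (Complex.arg (centerVec C₀ C) : Real.Angle)

/-- The real line through `0` spanned by a complex square root of `v` (for `v ≠ 0`). -/
def sqrtLine (v : ℂ) : Set ℂ :=
  {z | ∃ w : ℂ, w ^ 2 = v ∧ ∃ t : ℝ, z = (t : ℂ) * w}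

/-- An Apollonian curve associated to a pairwise externally tangent ordered triple
`(C₀, C₁, C₂)`. It is parametrized by the angles between `a = α(C₁)` and `b = α(C₂)` that face
the gap between the three circles, an interval of length less than `π`. -/
structure ApollonianCurve (C₀ : RoundDisc) (C₁ C₂ : GenDisc) where
  /-- a determination of `α(C₁)` -/
  a : ℝ
  /-- a determination of `α(C₂)` -/
  b : ℝ
  /-- the curve; only its values between `a` and `b` matter -/
  γ : ℝ → ℂ
  angle_a : (a : Real.Angle) = angle C₀ C₁
  angle_b : (b : Real.Angle) = angle C₀ C₂
  length_lt : |b - a| < Real.pi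
  continuousOn : ContinuousOn γ (Set.uIcc a b)
  sub_mem : ∀ C C' : GenDisc, Family C₀ C₁ C₂ C → Family C₀ C₁ C₂ C' →
    ExternallyTangent C C' → ∀ S : RoundDisc, IsSuccessor (.disc C₀) C C' S →
    ∀ t ∈ Set.uIcc a b, ∀ t' ∈ Set.uIcc a b,
      (t : Real.Angle) = angle C₀ C → (t' : Real.Angle) = angle C₀ C' →
      γ t - γ t' ∈ sqrtLine (S.center - C₀.center)

namespace ApollonianCurve

variable {C₀ : RoundDisc} {C₁ C₂ : GenDisc}

/-- The endpoint `γ(α(C₁))`. -/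
def source (g : ApollonianCurve C₀ C₁ C₂) : ℂ := g.γ g.a

/-- The endpoint `γ(α(C₂))`. -/
def target (g : ApollonianCurve C₀ C₁ C₂) : ℂ := g.γ g.b

/-- The image of the curve. -/
def image (g : ApollonianCurve C₀ C₁ C₂) : Set ℂ := g.γ '' Set.uIcc g.a g.b

end ApollonianCurve

/-- The region enclosed by `K`: the union of the bounded connected components of the complement
of `K`. -/
def enclosedRegion (K : Set ℂ) : Set ℂ :=
  {z | z ∉ K ∧ Bornology.IsBounded (connectedComponentIn Kᶜ z)}

/-- `T` is an Apollonian triangle, with vertices `p₁`, `p₂`, `p₃`, corresponding to the pairwise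
externally tangent `C₁`, `C₂`, `C₃` and to `C₀` externally tangent to each of them: the bounded
region enclosed by Apollonian curves for `(C₀, C₁, C₂)`, `(C₀, C₂, C₃)`, `(C₀, C₃, C₁)` with
matching endpoints. -/
structure IsApollonianTriangle (C₀ : RoundDisc) (C₁ C₂ C₃ : GenDisc) (p₁ p₂ p₃ : ℂ)
    (T : Set ℂ) : Prop where
  tangent₁₂ : ExternallyTangent C₁ C₂
  tangent₂₃ : ExternallyTangent C₂ C₃
  tangent₃₁ : ExternallyTangent C₃ C₁
  tangent₀₁ : ExternallyTangent (.disc C₀) C₁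
  tangent₀₂ : ExternallyTangent (.disc C₀) C₂
  tangent₀₃ : ExternallyTangent (.disc C₀) C₃
  enclosed : ∃ (γ₁₂ : ApollonianCurve C₀ C₁ C₂) (γ₂₃ : ApollonianCurve C₀ C₂ C₃)
      (γ₃₁ : ApollonianCurve C₀ C₃ C₁),
    γ₃₁.target = p₁ ∧ γ₁₂.source = p₁ ∧
    γ₁₂.target = p₂ ∧ γ₂₃.source = p₂ ∧
    γ₂₃.target = p₃ ∧ γ₃₁.source = p₃ ∧
    T = enclosedRegion (γ₁₂.image ∪ γ₂₃.image ∪ γ₃₁.image)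

/-- An Apollonian triangle corresponding to `C₁`, `C₂`, `C₃` and `C₀` is proper if `C₀` is the
successor of `C₁`, `C₂`, `C₃`. -/
def IsProper (C₀ : RoundDisc) (C₁ C₂ C₃ : GenDisc) : Prop :=
  IsSuccessor C₁ C₂ C₃ C₀

end Apollonian

/-! To a circle tangent to `C₀` attach a spinor, a square root of its center vector scaled so that
its squared length is the sum of the curvatures of both circles. With r₀ the radius of `C₀`, circles
with spinors u, v are tangent exactly when r₀ · `cross u v` = ±1 (`externallyTangent_disc_iff`), and
if u, v form an acute angle, u + v is a spinor of the successor (`exists_successor`).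

The defining condition of an Apollonian curve therefore says that its chord between tangent circles
is λ(u + v) for some real λ. Inserting the successor gives λ(u + v) = α(2u + v) + β(u + 2v), and
independence of u, v forces α = β = λ/3. The subdivision is thus rigid: in the triangle with corner
γ(t) − λu and edges λu, −λv, each step cuts the corner off at two thirds of its sides. Successive
subarcs shrink, so by continuity the whole curve is an affine image of one fixed self-similar set,
`modelCurve` (`IsSubarc.image_eq`).

The region between `modelCurve` and its corner consists of the triangle scaled by 2/3 and two affine
copies of itself with area ratio 1/9 each. Hence A = (4/9)A₀ + (2/9)A, that is A = (4/7)A₀, where A₀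
is the area of the corner triangle (`volume_modelRegion`).

In the proper case the three circles have spinors x, y, z with x + y + z = 0, any two at an obtuse
angle. The three chords close up, which makes their factors equal. So the three corner triangles
share one corner, the centroid of p₁p₂p₃, and tile that triangle. The union of the curves meets each
ray from the centroid once, so it encloses exactly the three model regions. -/

namespace Apollonian

open MeasureTheory Set
open scoped Pointwise

/-! ### The corner-cutting curve: self-similarity and monotonicity -/

/-- The affine map sending the triangle `0, 1, I` to the left corner left over when the corner
at `0` is cut off at two thirds of its sides. -/
noncomputable def cutLeft (z : ℂ) : ℂ := ⟨2 / 3 + (z.re - z.im) / 3, z.im / 3⟩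

/-- The mirror image of `cutLeft`. -/
noncomputable def cutRight (z : ℂ) : ℂ := ⟨z.re / 3, 2 / 3 + (z.im - z.re) / 3⟩

@[simp] lemma cutLeft_re (z : ℂ) : (cutLeft z).re = 2 / 3 + (z.re - z.im) / 3 := rfl
@[simp] lemma cutLeft_im (z : ℂ) : (cutLeft z).im = z.im / 3 := rfl
@[simp] lemma cutRight_re (z : ℂ) : (cutRight z).re = z.re / 3 := rfl
@[simp] lemma cutRight_im (z : ℂ) : (cutRight z).im = 2 / 3 + (z.im - z.re) / 3 := rfl

lemma cutLeft_one : cutLeft 1 = 1 := by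
  apply Complex.ext <;> norm_num

lemma cutRight_I : cutRight Complex.I = Complex.I := by
  apply Complex.ext <;> norm_num

lemma continuous_cutLeft : Continuous cutLeft := by
  have : cutLeft = fun z : ℂ => ((2 / 3 + (z.re - z.im) / 3 : ℝ) : ℂ) +
      ((z.im / 3 : ℝ) : ℂ) * Complex.I := by
    funext z; apply Complex.ext <;> simp
  rw [this]; fun_prop

lemma continuous_cutRight : Continuous cutRight := by
  have : cutRight = fun z : ℂ => ((z.re / 3 : ℝ) : ℂ) +
      ((2 / 3 + (z.im - z.re) / 3 : ℝ) : ℂ) * Complex.I := by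
    funext z; apply Complex.ext <;> simp
  rw [this]; fun_prop

/-- The vertices of the polygons obtained by repeatedly cutting corners. -/
inductive IsCurveVertex : ℂ → Prop
  | one : IsCurveVertex 1
  | I : IsCurveVertex Complex.I
  | left {z : ℂ} : IsCurveVertex z → IsCurveVertex (cutLeft z)
  | right {z : ℂ} : IsCurveVertex z → IsCurveVertex (cutRight z)

/-- The limit curve of corner cutting in the triangle `0, 1, I`. -/
def modelCurve : Set ℂ := closure {z | IsCurveVertex z}

/-- The triangle with vertices `0, 1, I`. -/
def cornerTriangle : Set ℂ := {z | 0 ≤ z.re ∧ 0 ≤ z.im ∧ z.re + z.im ≤ 1}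

lemma isClosed_cornerTriangle : IsClosed cornerTriangle := by
  refine (isClosed_le continuous_const Complex.continuous_re).inter
    ((isClosed_le continuous_const Complex.continuous_im).inter
      (isClosed_le (Complex.continuous_re.add Complex.continuous_im) continuous_const))

lemma IsCurveVertex.mem_cornerTriangle {z : ℂ} (hz : IsCurveVertex z) : z ∈ cornerTriangle := by
  induction hz with
  | one => simp [cornerTriangle]
  | I => simp [cornerTriangle]
  | left _ ih =>
    obtain ⟨h1, h2, h3⟩ := ih
    refine ⟨?_, ?_, ?_⟩ <;> simp <;> linarith
  | right _ ih =>
    obtain ⟨h1, h2, h3⟩ := ih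
    refine ⟨?_, ?_, ?_⟩ <;> simp <;> linarith

lemma modelCurve_subset : modelCurve ⊆ cornerTriangle :=
  closure_minimal (fun _ h => h.mem_cornerTriangle) isClosed_cornerTriangle

lemma isClosed_modelCurve : IsClosed modelCurve := isClosed_closure

lemma two_thirds_le {z : ℂ} (hz : z ∈ modelCurve) : 2 / 3 ≤ z.re + z.im := by
  refine closure_minimal (t := {z : ℂ | 2 / 3 ≤ z.re + z.im}) ?_
    (isClosed_le continuous_const (by fun_prop)) hz
  intro z hz
  cases hz with
  | one => norm_num
  | I => norm_num
  | left h => have := h.mem_cornerTriangle.1; simp; linarith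
  | right h => have := h.mem_cornerTriangle.2.1; simp; linarith

lemma isCompact_cornerTriangle : IsCompact cornerTriangle := by
  refine Metric.isCompact_of_isClosed_isBounded isClosed_cornerTriangle ?_
  refine (Metric.isBounded_closedBall (x := (0 : ℂ)) (r := 1)).subset ?_
  rintro z ⟨h1, h2, h3⟩
  rw [mem_closedBall_zero_iff]
  have := Complex.norm_le_abs_re_add_abs_im z
  rw [abs_of_nonneg h1, abs_of_nonneg h2] at this
  linarith

lemma isCompact_modelCurve : IsCompact modelCurve :=
  isCompact_cornerTriangle.of_isClosed_subset isClosed_modelCurve modelCurve_subset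

lemma one_mem_modelCurve : (1 : ℂ) ∈ modelCurve := subset_closure IsCurveVertex.one

lemma I_mem_modelCurve : Complex.I ∈ modelCurve := subset_closure IsCurveVertex.I

lemma cutLeft_mem {z : ℂ} (hz : z ∈ modelCurve) : cutLeft z ∈ modelCurve :=
  map_mem_closure continuous_cutLeft hz fun _ h => IsCurveVertex.left h

lemma cutRight_mem {z : ℂ} (hz : z ∈ modelCurve) : cutRight z ∈ modelCurve :=
  map_mem_closure continuous_cutRight hz fun _ h => IsCurveVertex.right h

/-- The endpoints 1 and `I` are fixed by the respective cut maps, so the generating vertices are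
covered as well; compactness keeps the union closed. -/
lemma modelCurve_subset_union :
    modelCurve ⊆ cutLeft '' modelCurve ∪ cutRight '' modelCurve := by
  refine closure_minimal ?_ ((isCompact_modelCurve.image continuous_cutLeft).isClosed.union
    (isCompact_modelCurve.image continuous_cutRight).isClosed)
  rintro z hz
  cases hz with
  | one => exact Or.inl ⟨1, one_mem_modelCurve, cutLeft_one⟩
  | I => exact Or.inr ⟨_, I_mem_modelCurve, cutRight_I⟩
  | left h => exact Or.inl ⟨_, subset_closure h, rfl⟩
  | right h => exact Or.inr ⟨_, subset_closure h, rfl⟩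

/-- Two points in the image of the same cut map: it turns a difference (dx, dy) into one with
product (dx·dy − dy²)/9 or (dx·dy − dx²)/9, so the sign persists. Points in images of different cut
maps are separated by (1/3, 1/3), one lying weakly right of and below it, the other left of and
above it. -/
lemma IsCurveVertex.antitone {z w : ℂ} (hz : IsCurveVertex z) (hw : IsCurveVertex w) :
    (z.re - w.re) * (z.im - w.im) ≤ 0 := by
  induction hz generalizing w with
  | one =>
    obtain ⟨h1, h2, h3⟩ := hw.mem_cornerTriangle
    simp; nlinarith
  | I =>
    obtain ⟨h1, h2, h3⟩ := hw.mem_cornerTriangle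
    simp; nlinarith
  | @left z hz ih =>
    have hz' := hz.left.mem_cornerTriangle
    obtain ⟨h1, h2, h3⟩ := hz.mem_cornerTriangle
    cases hw with
    | one => obtain ⟨h1, h2, h3⟩ := hz'; simp only [Complex.one_re, Complex.one_im]; nlinarith
    | I => obtain ⟨h1, h2, h3⟩ := hz'; simp only [Complex.I_re, Complex.I_im]; nlinarith
    | @left w hw => have := ih hw; simp; nlinarith [sq_nonneg (z.im - w.im)]
    | @right w hw =>
      obtain ⟨h4, h5, h6⟩ := hw.mem_cornerTriangle
      apply mul_nonpos_of_nonneg_of_nonpos <;> simp <;> linarith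
  | @right z hz ih =>
    have hz' := hz.right.mem_cornerTriangle
    obtain ⟨h1, h2, h3⟩ := hz.mem_cornerTriangle
    cases hw with
    | one => obtain ⟨h1, h2, h3⟩ := hz'; simp only [Complex.one_re, Complex.one_im]; nlinarith
    | I => obtain ⟨h1, h2, h3⟩ := hz'; simp only [Complex.I_re, Complex.I_im]; nlinarith
    | @right w hw => have := ih hw; simp; nlinarith [sq_nonneg (z.re - w.re)]
    | @left w hw =>
      obtain ⟨h4, h5, h6⟩ := hw.mem_cornerTriangle
      apply mul_nonpos_of_nonpos_of_nonneg <;> simp <;> linarith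

lemma modelCurve_antitone {z w : ℂ} (hz : z ∈ modelCurve) (hw : w ∈ modelCurve) :
    (z.re - w.re) * (z.im - w.im) ≤ 0 := by
  have key : ∀ w, IsCurveVertex w → ∀ z ∈ modelCurve, (z.re - w.re) * (z.im - w.im) ≤ 0 := by
    intro w hw
    refine closure_minimal (t := {z : ℂ | (z.re - w.re) * (z.im - w.im) ≤ 0})
      (fun z hz => hz.antitone hw) (isClosed_le (by fun_prop) continuous_const)
  exact closure_minimal (t := {w : ℂ | (z.re - w.re) * (z.im - w.im) ≤ 0})
      (fun w hw => key w hw z hz) (isClosed_le (by fun_prop) continuous_const) hw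

/-- Weak monotonicity would allow a segment on the axis. Self-similarity excludes it: a point of
height 0 has a `cutLeft` preimage on the curve, again of height 0 and three times as far from 1,
while distances stay bounded. -/
lemma eq_one_of_im_eq_zero {z : ℂ} (hz : z ∈ modelCurve) (h : z.im = 0) : z = 1 := by
  have key : ∀ n : ℕ, ∀ z ∈ modelCurve, z.im = 0 → 1 - z.re ≤ (1 / 3) ^ n := by
    intro n
    induction n with
    | zero => intro z hz _; have := (modelCurve_subset hz).1; simp; linarith
    | succ n ih =>
      intro z hz h
      rcases modelCurve_subset_union hz with ⟨w, hw, rfl⟩ | ⟨w, hw, rfl⟩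
      · have h0 : w.im = 0 := by simpa using h
        have := ih w hw h0
        rw [pow_succ, cutLeft_re]; linarith
      · obtain ⟨h1, h2, h3⟩ := modelCurve_subset hw
        simp at h; linarith
  have hle : 1 - z.re ≤ 0 := ge_of_tendsto'
    (tendsto_pow_atTop_nhds_zero_of_lt_one (by norm_num) (by norm_num : (1 / 3 : ℝ) < 1))
    fun n => key n z hz h
  obtain ⟨h1, h2, h3⟩ := modelCurve_subset hz
  apply Complex.ext <;> simp <;> linarith

lemma eq_I_of_re_eq_zero {z : ℂ} (hz : z ∈ modelCurve) (h : z.re = 0) : z = Complex.I := by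
  have key : ∀ n : ℕ, ∀ z ∈ modelCurve, z.re = 0 → 1 - z.im ≤ (1 / 3) ^ n := by
    intro n
    induction n with
    | zero => intro z hz _; have := (modelCurve_subset hz).2.1; simp; linarith
    | succ n ih =>
      intro z hz h
      rcases modelCurve_subset_union hz with ⟨w, hw, rfl⟩ | ⟨w, hw, rfl⟩
      · obtain ⟨h1, h2, h3⟩ := modelCurve_subset hw
        simp at h; linarith
      · have h0 : w.re = 0 := by simpa using h
        have := ih w hw h0
        rw [pow_succ, cutRight_im]; linarith
  have hle : 1 - z.im ≤ 0 := ge_of_tendsto'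
    (tendsto_pow_atTop_nhds_zero_of_lt_one (by norm_num) (by norm_num : (1 / 3 : ℝ) < 1))
    fun n => key n z hz h
  obtain ⟨h1, h2, h3⟩ := modelCurve_subset hz
  apply Complex.ext <;> simp <;> linarith

lemma re_add_im_pos {z : ℂ} (hz : z ∈ modelCurve) : 0 < z.re + z.im :=
  lt_of_lt_of_le (by norm_num) (two_thirds_le hz)

/-- Moving along a ray inside the open quadrant increases both coordinates, against monotonicity; on
the axes only the endpoints are available. -/
lemma ray_unique {z : ℂ} {s : ℝ} (hz : z ∈ modelCurve) (h : s • z ∈ modelCurve) :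
    s = 1 := by
  obtain ⟨h1, h2, h3⟩ := modelCurve_subset hz
  by_cases hre : z.re = 0
  · have e1 := eq_I_of_re_eq_zero hz hre
    have e2 := eq_I_of_re_eq_zero h (by simp [hre])
    have := congrArg Complex.im e2
    simpa [e1] using this
  by_cases him : z.im = 0
  · have e1 := eq_one_of_im_eq_zero hz him
    have e2 := eq_one_of_im_eq_zero h (by simp [him])
    have := congrArg Complex.re e2
    simpa [e1] using this
  have hp : 0 < z.re * z.im := mul_pos (lt_of_le_of_ne h1 (Ne.symm hre))
    (lt_of_le_of_ne h2 (Ne.symm him))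
  have := modelCurve_antitone h hz
  simp only [Complex.smul_re, Complex.smul_im, smul_eq_mul] at this
  have h4 : (s - 1) ^ 2 * (z.re * z.im) ≤ 0 := by nlinarith
  have h5 : (s - 1) ^ 2 ≤ 0 := by
    by_contra hc; push Not at hc
    exact absurd h4 (not_le.mpr (mul_pos hc hp))
  nlinarith [sq_nonneg (s - 1), pow_eq_zero_iff (two_ne_zero) |>.mp (le_antisymm h5 (sq_nonneg _))]

/-- Connectedness of `modelCurve` stays a hypothesis from here on; it is finally read off from the
continuity of a given Apollonian curve. -/
lemma exists_ray (hc : IsPreconnected modelCurve) {a b : ℝ} (ha : 0 ≤ a) (hb : 0 ≤ b)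
    (hab : 0 < a + b) : ∃ s : ℝ, 0 < s ∧ (⟨s * a, s * b⟩ : ℂ) ∈ modelCurve := by
  obtain ⟨k, hk, hk0⟩ := hc.intermediate_value one_mem_modelCurve I_mem_modelCurve
    (f := fun k : ℂ => a * k.im - b * k.re) (by fun_prop)
    (show (0 : ℝ) ∈ Icc _ _ by simp [ha, hb])
  have hp := re_add_im_pos hk
  refine ⟨(k.re + k.im) / (a + b), by positivity, ?_⟩
  convert hk using 1
  simp only at hk0
  apply Complex.ext <;> simp <;> field_simp <;> linarith

lemma exists_im_eq (hc : IsPreconnected modelCurve) {y : ℝ} (h0 : 0 ≤ y) (h1 : y ≤ 1) :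
    ∃ k ∈ modelCurve, k.im = y :=
  hc.intermediate_value one_mem_modelCurve I_mem_modelCurve
    (f := Complex.im) (by fun_prop) (show y ∈ Icc _ _ by simp [h0, h1])

lemma exists_re_eq (hc : IsPreconnected modelCurve) {x : ℝ} (h0 : 0 ≤ x) (h1 : x ≤ 1) :
    ∃ k ∈ modelCurve, k.re = x :=
  hc.intermediate_value I_mem_modelCurve one_mem_modelCurve
    (f := Complex.re) (by fun_prop) (show x ∈ Icc _ _ by simp [h0, h1])

/-! ### The region under the model curve -/

/-- The points of the first quadrant below `modelCurve`. -/
def modelRegion : Set ℂ :=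
  {z | 0 ≤ z.re ∧ 0 ≤ z.im ∧ ∃ k ∈ modelCurve, z.re ≤ k.re ∧ z.im ≤ k.im}

lemma modelRegion_subset : modelRegion ⊆ cornerTriangle := by
  rintro z ⟨h1, h2, k, hk, h3, h4⟩
  exact ⟨h1, h2, by linarith [(modelCurve_subset hk).2.2]⟩

/-- The dominating point may be taken at the same height. This is needed because `cutLeft` shears:
it respects comparison along horizontal lines but not the coordinatewise order. -/
lemma exists_im_eq_of_mem_modelRegion (hc : IsPreconnected modelCurve) {z : ℂ}
    (hz : z ∈ modelRegion) : ∃ k ∈ modelCurve, k.im = z.im ∧ z.re ≤ k.re := by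
  obtain ⟨h1, h2, k, hk, h3, h4⟩ := hz
  obtain ⟨h5, h6, h7⟩ := modelCurve_subset hk
  rcases h4.lt_or_eq with h4 | h4
  · obtain ⟨l, hl, hle⟩ := exists_im_eq hc h2 (by linarith)
    refine ⟨l, hl, hle, ?_⟩
    have := modelCurve_antitone hk hl
    rw [hle] at this
    by_contra! hlt
    exact absurd this (not_le.mpr (mul_pos (by linarith) (by linarith)))
  · exact ⟨k, hk, h4.symm, h3⟩

lemma exists_re_eq_of_mem_modelRegion (hc : IsPreconnected modelCurve) {z : ℂ}
    (hz : z ∈ modelRegion) : ∃ k ∈ modelCurve, k.re = z.re ∧ z.im ≤ k.im := by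
  obtain ⟨h1, h2, k, hk, h3, h4⟩ := hz
  obtain ⟨h5, h6, h7⟩ := modelCurve_subset hk
  rcases h3.lt_or_eq with h3 | h3
  · obtain ⟨l, hl, hle⟩ := exists_re_eq hc h1 (by linarith)
    refine ⟨l, hl, hle, ?_⟩
    have := modelCurve_antitone hk hl
    rw [hle] at this
    by_contra! hlt
    exact absurd this (not_le.mpr (mul_pos (by linarith) (by linarith)))
  · exact ⟨k, hk, h3.symm, h4⟩

lemma modelRegion_eq_cone (hc : IsPreconnected modelCurve) :
    modelRegion = (fun p : ℝ × ℂ => p.1 • p.2) '' (Icc 0 1 ×ˢ modelCurve) := by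
  ext z
  constructor
  · rintro ⟨h1, h2, k, hk, h3, h4⟩
    obtain ⟨h5, h6, h7⟩ := modelCurve_subset hk
    by_cases h0 : 0 < z.re + z.im
    · obtain ⟨s, hs, hsz⟩ := exists_ray hc h1 h2 h0
      have hsz' : s • z ∈ modelCurve := by
        convert hsz using 1
        apply Complex.ext <;> simp
      refine ⟨(s⁻¹, s • z), ⟨⟨by positivity, inv_le_one_of_one_le₀ ?_⟩, hsz'⟩, ?_⟩
      · by_contra! hlt
        by_cases hre : z.re = 0
        · have := congrArg Complex.im (eq_I_of_re_eq_zero hsz' (by simp [hre]))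
          simp at this
          nlinarith
        by_cases him : z.im = 0
        · have := congrArg Complex.re (eq_one_of_im_eq_zero hsz' (by simp [him]))
          simp at this
          nlinarith
        have hre' := lt_of_le_of_ne h1 (Ne.symm hre)
        have him' := lt_of_le_of_ne h2 (Ne.symm him)
        have := modelCurve_antitone hk hsz'
        refine absurd this (not_le.mpr (mul_pos ?_ ?_)) <;> simp <;> nlinarith
      · simp [hs.ne']
    · refine ⟨(0, 1), ⟨by simp, one_mem_modelCurve⟩, ?_⟩
      apply Complex.ext <;> simp <;> linarith
  · rintro ⟨⟨s, k⟩, ⟨⟨hs0, hs1⟩, hk⟩, rfl⟩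
    obtain ⟨h5, h6, h7⟩ := modelCurve_subset hk
    simp only at hs0 hs1 hk h5 h6
    refine ⟨by simp; positivity, by simp; positivity, k, hk, ?_, ?_⟩ <;> simp <;> nlinarith

lemma isCompact_modelRegion (hc : IsPreconnected modelCurve) : IsCompact modelRegion := by
  rw [modelRegion_eq_cone hc]
  exact (isCompact_Icc.prod isCompact_modelCurve).image (by fun_prop)

lemma cutLeft_mem_modelRegion (hc : IsPreconnected modelCurve) {z : ℂ} (hz : z ∈ modelRegion) :
    cutLeft z ∈ modelRegion := by
  obtain ⟨k, hk, h1, h2⟩ := exists_im_eq_of_mem_modelRegion hc hz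
  obtain ⟨h3, h4, h5⟩ := modelRegion_subset hz
  refine ⟨?_, ?_, _, cutLeft_mem hk, ?_, ?_⟩ <;> simp <;> linarith

lemma cutRight_mem_modelRegion (hc : IsPreconnected modelCurve) {z : ℂ} (hz : z ∈ modelRegion) :
    cutRight z ∈ modelRegion := by
  obtain ⟨k, hk, h1, h2⟩ := exists_re_eq_of_mem_modelRegion hc hz
  obtain ⟨h3, h4, h5⟩ := modelRegion_subset hz
  refine ⟨?_, ?_, _, cutRight_mem hk, ?_, ?_⟩ <;> simp <;> linarith

/-- The point where `modelCurve` meets the diagonal. -/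
lemma diagonal_mem_modelCurve : (⟨1 / 3, 1 / 3⟩ : ℂ) ∈ modelCurve := by
  convert cutLeft_mem I_mem_modelCurve using 1
  apply Complex.ext <;> norm_num

lemma modelRegion_eq_union (hc : IsPreconnected modelCurve) :
    modelRegion = (2 / 3 : ℝ) • cornerTriangle ∪
      (cutLeft '' modelRegion ∪ cutRight '' modelRegion) := by
  have hd := diagonal_mem_modelCurve
  apply subset_antisymm
  · intro z hz
    by_cases hsum : z.re + z.im ≤ 2 / 3
    · left
      refine ⟨(3 / 2 : ℝ) • z, ⟨?_, ?_, ?_⟩, ?_⟩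
      · simpa using hz.1
      · simpa using hz.2.1
      · simp; linarith
      · simp only [smul_smul]; norm_num
    right
    push Not at hsum
    rcases le_total z.im z.re with h | h
    · left
      obtain ⟨k, hk, h1, h2⟩ := exists_im_eq_of_mem_modelRegion hc hz
      rcases modelCurve_subset_union hk with ⟨l, hl, rfl⟩ | ⟨l, hl, rfl⟩
      · refine ⟨⟨3 * z.re - 2 + 3 * z.im, 3 * z.im⟩, ⟨?_, ?_, l, hl, ?_, ?_⟩, ?_⟩
        · simp; linarith
        · have := hz.2.1; simpa
        · simp at h1 h2 ⊢; linarith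
        · simp at h1 h2 ⊢; linarith
        · apply Complex.ext <;> simp <;> ring
      -- A point of the `cutRight` half has real part at most 1/3, so z.im ≤ z.re ≤ 1/3,
      -- contradicting `hsum`.
      · exfalso
        obtain ⟨h3, h4, h5⟩ := modelCurve_subset hl
        have := modelCurve_antitone hk hd
        simp only [cutRight_re, cutRight_im] at h1 h2 this
        linarith
    · right
      obtain ⟨k, hk, h1, h2⟩ := exists_re_eq_of_mem_modelRegion hc hz
      rcases modelCurve_subset_union hk with ⟨l, hl, rfl⟩ | ⟨l, hl, rfl⟩
      · exfalso
        obtain ⟨h3, h4, h5⟩ := modelCurve_subset hl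
        have := modelCurve_antitone hk hd
        simp only [cutLeft_re, cutLeft_im] at h1 h2 this
        linarith
      · refine ⟨⟨3 * z.re, 3 * z.im - 2 + 3 * z.re⟩, ⟨?_, ?_, l, hl, ?_, ?_⟩, ?_⟩
        · have := hz.1; simpa
        · simp; linarith
        · simp at h1 h2 ⊢; linarith
        · simp at h1 h2 ⊢; linarith
        · apply Complex.ext <;> simp <;> ring
  · refine union_subset ?_ (union_subset ?_ ?_)
    · rintro _ ⟨z, ⟨h1, h2, h3⟩, rfl⟩
      obtain ⟨k, hk, hk1⟩ := exists_im_eq hc (y := 2 / 3 * z.im) (by linarith) (by linarith)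
      have := two_thirds_le hk
      refine ⟨by simpa using h1, by simpa using h2, k, hk, ?_, by simp [hk1]⟩
      simp; linarith
    · rintro _ ⟨z, hz, rfl⟩
      exact cutLeft_mem_modelRegion hc hz
    · rintro _ ⟨z, hz, rfl⟩
      exact cutRight_mem_modelRegion hc hz

/-! ### Affine frames and areas -/

/-- The affine map sending `0, 1, I` to `O, O + x, O + y`. -/
def frame (O x y z : ℂ) : ℂ := O + (z.re * x + z.im * y)

/-- The determinant of two plane vectors. -/
def cross (x y : ℂ) : ℝ := x.re * y.im - x.im * y.re

lemma continuous_frame (O x y : ℂ) : Continuous (frame O x y) := by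
  unfold frame; fun_prop

lemma volume_frame_image (O x y : ℂ) (s : Set ℂ) :
    volume (frame O x y '' s) = ENNReal.ofReal |cross x y| * volume s := by
  let f : ℂ →ₗ[ℝ] ℂ :=
    { toFun := fun z => z.re * x + z.im * y
      map_add' := fun a b => by simp; ring
      map_smul' := fun c a => by simp; ring }
  have hf : frame O x y '' s = (fun z => O + z) '' (f '' s) := by
    rw [image_image]; rfl
  have hdet : LinearMap.det f = cross x y := by
    rw [← LinearMap.det_toMatrix Complex.basisOneI, Matrix.det_fin_two]
    simp [LinearMap.toMatrix_apply, f, cross]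
    ring
  rw [hf, image_add_left, measure_preimage_add, Measure.addHaar_image_linearMap, hdet]

lemma volume_line {a b : ℝ} (h : a ≠ 0 ∨ b ≠ 0) (c : ℝ) :
    volume {z : ℂ | a * z.re + b * z.im = c} = 0 := by
  let f : ℂ →ₗ[ℝ] ℝ := a • Complex.reLm + b • Complex.imLm
  have hs : {z : ℂ | a * z.re + b * z.im = c} =
      ((AffineSubspace.comap f.toAffineMap (AffineSubspace.mk' c ⊥) :
        AffineSubspace ℝ ℂ) : Set ℂ) := by
    ext z
    simp [f, AffineSubspace.mem_mk', sub_eq_zero]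
  rw [hs]
  refine Measure.addHaar_affineSubspace _ _ fun htop => ?_
  have hall : ∀ z : ℂ, a * z.re + b * z.im = c := by
    intro z
    have : z ∈ ((AffineSubspace.comap f.toAffineMap (AffineSubspace.mk' c ⊥) :
        AffineSubspace ℝ ℂ) : Set ℂ) := by rw [htop]; trivial
    rw [← hs] at this
    exact this
  have h0 := hall 0
  have h1 := hall 1
  have h2 := hall Complex.I
  simp at h0 h1 h2
  rcases h with h | h <;> apply h <;> linarith

lemma cutLeft_eq_frame : cutLeft = frame (2 / 3) (1 / 3) ⟨-1 / 3, 1 / 3⟩ := by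
  funext z; apply Complex.ext <;> simp [frame] <;> ring

lemma cutRight_eq_frame : cutRight = frame ⟨0, 2 / 3⟩ ⟨1 / 3, -1 / 3⟩ ⟨0, 1 / 3⟩ := by
  funext z; apply Complex.ext <;> simp [frame] <;> ring

lemma volume_cutLeft_image (s : Set ℂ) : volume (cutLeft '' s) = 9⁻¹ * volume s := by
  rw [cutLeft_eq_frame, volume_frame_image]
  congr 1
  rw [← ENNReal.ofReal_ofNat, ← ENNReal.ofReal_inv_of_pos (by norm_num)]
  congr 1
  norm_num [cross]

lemma volume_cutRight_image (s : Set ℂ) : volume (cutRight '' s) = 9⁻¹ * volume s := by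
  rw [cutRight_eq_frame, volume_frame_image]
  congr 1
  rw [← ENNReal.ofReal_ofNat, ← ENNReal.ofReal_inv_of_pos (by norm_num)]
  congr 1
  norm_num [cross]

/-- Two copies of area ratio 1/9 cover the curve, so its finite measure is at most 2/9 of itself. -/
lemma volume_modelCurve : volume modelCurve = 0 := by
  have h1 : volume modelCurve ≤ 9⁻¹ * volume modelCurve + 9⁻¹ * volume modelCurve := by
    refine (measure_mono modelCurve_subset_union).trans ((measure_union_le _ _).trans ?_)
    rw [volume_cutLeft_image, volume_cutRight_image]
  have hfin : volume modelCurve ≠ ⊤ := isCompact_modelCurve.measure_lt_top.ne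
  lift volume modelCurve to NNReal using hfin with v
  have h2 : v ≤ 9⁻¹ * v + 9⁻¹ * v := by
    rw [← ENNReal.coe_le_coe]; push_cast
    convert h1 <;> simp
  have h3 : (v : ℝ) ≤ 9⁻¹ * v + 9⁻¹ * v := by exact_mod_cast h2
  have : (v : ℝ) ≤ 0 := by linarith
  have : v = 0 := by exact_mod_cast le_antisymm this v.2
  simp [this]

lemma volume_modelRegion (hc : IsPreconnected modelCurve) :
    volume modelRegion = 4 / 7 * volume cornerTriangle := by
  have hD := isCompact_modelRegion hc
  have hL := hD.image continuous_cutLeft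
  have hR := hD.image continuous_cutRight
  have hLR : AEDisjoint volume (cutLeft '' modelRegion) (cutRight '' modelRegion) := by
    refine measure_mono_null ?_ (volume_line (a := 1) (b := -1) (by norm_num) 0)
    rintro _ ⟨⟨z, hz, rfl⟩, ⟨w, hw, hzw⟩⟩
    obtain ⟨h1, h2, h3⟩ := modelRegion_subset hz
    obtain ⟨h4, h5, h6⟩ := modelRegion_subset hw
    have e1 := congrArg Complex.re hzw
    have e2 := congrArg Complex.im hzw
    simp at e1 e2 ⊢
    linarith
  have hT : AEDisjoint volume ((2 / 3 : ℝ) • cornerTriangle)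
      (cutLeft '' modelRegion ∪ cutRight '' modelRegion) := by
    refine measure_mono_null ?_ (volume_line (a := 1) (b := 1) (by norm_num) (2 / 3))
    rintro _ ⟨⟨z, ⟨h1, h2, h3⟩, rfl⟩, ⟨w, hw, hzw⟩ | ⟨w, hw, hzw⟩⟩ <;>
    · obtain ⟨h4, h5, h6⟩ := modelRegion_subset hw
      have e1 := congrArg Complex.re hzw
      have e2 := congrArg Complex.im hzw
      simp at e1 e2 ⊢
      linarith
  -- The area equation A = (4/9)A₀ + (1/9)A + (1/9)A, the pieces overlapping only on lines.
  have key := congrArg volume (modelRegion_eq_union hc)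
  rw [measure_union₀ (hL.union hR).measurableSet.nullMeasurableSet hT,
    measure_union₀ hR.measurableSet.nullMeasurableSet hLR, volume_cutLeft_image,
    volume_cutRight_image, Measure.addHaar_smul] at key
  have f1 : volume modelRegion ≠ ⊤ := hD.measure_lt_top.ne
  have f2 : volume cornerTriangle ≠ ⊤ := isCompact_cornerTriangle.measure_lt_top.ne
  lift volume modelRegion to NNReal using f1 with v
  lift volume cornerTriangle to NNReal using f2 with t
  have e : ENNReal.ofReal |(2 / 3 : ℝ) ^ Module.finrank ℝ ℂ| = ((4 / 9 : NNReal) : ENNReal) := by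
    rw [Complex.finrank_real_complex, ENNReal.ofReal]
    congr 1
    ext
    rw [Real.coe_toNNReal _ (abs_nonneg _)]
    norm_num
  rw [e] at key
  have key2 : v = 4 / 9 * t + (9⁻¹ * v + 9⁻¹ * v) := by
    rw [← ENNReal.coe_inj]; push_cast
    convert key <;> simp
  have key3 : v = 4 / 7 * t := by
    ext
    have := congrArg NNReal.toReal key2
    push_cast at this ⊢
    linarith
  rw [key3]
  push_cast
  congr 1
  rw [ENNReal.coe_div (by norm_num)]; simp

/-! ### Spinors of circles tangent to `C₀` -/

/-- The scalar product of two plane vectors. -/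
def dot (x y : ℂ) : ℝ := x.re * y.re + x.im * y.im

lemma normSq_add_eq (x y : ℂ) :
    Complex.normSq (x + y) = Complex.normSq x + Complex.normSq y + 2 * dot x y := by
  simp only [dot, Complex.normSq_apply, Complex.add_re, Complex.add_im]; ring

/-- `u` is a spinor of `C`, a circle tangent to `C₀`: a suitably normalized square root of the
vector from the center of `C₀` to the center of `C`. -/
def IsSpinor (C₀ : RoundDisc) (u : ℂ) : GenDisc → Prop
  | .disc D => ExternallyTangent (.disc C₀) (.disc D) ∧
      D.center - C₀.center = ((C₀.radius * D.radius : ℝ) : ℂ) * u ^ 2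
  | .halfPlane n hn d => ExternallyTangent (.disc C₀) (.halfPlane n hn d) ∧
      n = (C₀.radius : ℂ) * u ^ 2

section Spinors

variable {C₀ : RoundDisc} {C C' : GenDisc} {u v : ℂ}

lemma IsSpinor.normSq_eq (h : IsSpinor C₀ u C) :
    Complex.normSq u = C₀.radius⁻¹ + C.curvature := by
  have h0 := C₀.radius_pos
  cases C with
  | disc D =>
    have h1 := D.radius_pos
    obtain ⟨ht, he⟩ := h
    simp only [ExternallyTangent, dist_comm C₀.center, dist_eq_norm] at ht
    rw [he, norm_mul, norm_pow, Complex.norm_real, Real.norm_of_nonneg (by positivity),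
      Complex.sq_norm] at ht
    simp only [GenDisc.curvature]
    field_simp
    linarith
  | halfPlane n hn d =>
    obtain ⟨ht, he⟩ := h
    rw [he, norm_mul, norm_pow, Complex.norm_real, Real.norm_of_nonneg (by positivity),
      Complex.sq_norm] at hn
    simp only [GenDisc.curvature]
    field_simp
    linarith

lemma curvature_nonneg (C : GenDisc) : 0 ≤ C.curvature := by
  cases C with
  | disc D => exact (inv_pos.mpr D.radius_pos).le
  | halfPlane n hn d => exact le_rfl

lemma IsSpinor.inv_radius_le (h : IsSpinor C₀ u C) : C₀.radius⁻¹ ≤ Complex.normSq u := by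
  rw [h.normSq_eq]; linarith [curvature_nonneg C]

lemma ExternallyTangent.symm (h : ExternallyTangent C C') : ExternallyTangent C' C := by
  cases C <;> cases C' <;> simp only [ExternallyTangent] at h ⊢
  · rw [dist_comm, h, add_comm]
  · exact h
  · exact h

lemma IsSpinor.tangent (h : IsSpinor C₀ u C) : ExternallyTangent (.disc C₀) C := by
  cases C <;> exact h.1

/-- Tangency of circles tangent to `C₀` in terms of their spinors. -/
lemma externallyTangent_disc_iff {D : RoundDisc} (hu : IsSpinor C₀ u (.disc D))
    (hv : IsSpinor C₀ v C) :
    ExternallyTangent (.disc D) C ↔ (C₀.radius * cross u v) ^ 2 = 1 := by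
  have h0 := C₀.radius_pos
  have h1 := D.radius_pos
  have hnu := hu.normSq_eq
  have hnv := hv.normSq_eq
  cases C with
  | disc E =>
    have h2 := E.radius_pos
    simp only [GenDisc.curvature] at hnu hnv
    simp only [ExternallyTangent]
    have hsub : D.center - E.center = ((C₀.radius * D.radius : ℝ) : ℂ) * u ^ 2 -
        ((C₀.radius * E.radius : ℝ) : ℂ) * v ^ 2 := by
      rw [← hu.2, ← hv.2]; ring
    -- This is |au² − bv²|² = (a|u|² − b|v|²)² + 4ab · `cross u v`² for real a, b; by the
    -- normalization the first bracket is the difference of the radii.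
    have hd : dist D.center E.center ^ 2 = (D.radius - E.radius) ^ 2 +
        4 * D.radius * E.radius * (C₀.radius * cross u v) ^ 2 := by
      have h3 : dist D.center E.center ^ 2 = (C₀.radius * D.radius * Complex.normSq u -
          C₀.radius * E.radius * Complex.normSq v) ^ 2 +
          4 * D.radius * E.radius * (C₀.radius * cross u v) ^ 2 := by
        rw [dist_eq_norm, hsub, Complex.sq_norm]
        simp only [Complex.normSq_apply, cross, pow_two, Complex.sub_re, Complex.sub_im,
          Complex.ofReal_re, Complex.ofReal_im, Complex.mul_re, Complex.mul_im]
        ring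
      rw [h3, hnu, hnv]
      congr 1
      field_simp
      ring
    have hsq : dist D.center E.center = D.radius + E.radius ↔
        dist D.center E.center ^ 2 = (D.radius + E.radius) ^ 2 :=
      (sq_eq_sq₀ dist_nonneg (by positivity)).symm
    rw [hsq, hd]
    have hpos : 0 < 4 * D.radius * E.radius := by positivity
    constructor
    · intro h
      apply mul_left_cancel₀ hpos.ne'
      linear_combination h
    · intro h
      linear_combination (4 * D.radius * E.radius) * h
  | halfPlane n hn d =>
    simp only [GenDisc.curvature, add_zero] at hnu hnv
    obtain ⟨ht, hn'⟩ := hv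
    simp only [ExternallyTangent] at ht ⊢
    have hc : D.center = C₀.center + ((C₀.radius * D.radius : ℝ) : ℂ) * u ^ 2 := by
      rw [← hu.2]; ring
    have hi : inner ℝ n D.center = inner ℝ n C₀.center +
        (C₀.radius * Complex.normSq v) * (C₀.radius * D.radius * Complex.normSq u) -
        2 * D.radius * (C₀.radius * cross u v) ^ 2 := by
      rw [hc, inner_add_right, hn', add_sub_assoc]
      congr 1
      simp only [Complex.inner, Complex.normSq_apply, cross, pow_two, map_mul,
        Complex.conj_ofReal, Complex.mul_re, Complex.mul_im,
        Complex.conj_re, Complex.conj_im, Complex.ofReal_re, Complex.ofReal_im]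
      ring
    have e1 : C₀.radius * Complex.normSq v = 1 := by rw [hnv]; field_simp
    have e2 : C₀.radius * D.radius * Complex.normSq u = D.radius + C₀.radius := by
      rw [hnu]; field_simp
    rw [hi, e1, e2]
    constructor
    · intro h
      apply mul_left_cancel₀ h1.ne'
      linarith
    · intro h
      rw [h]; linarith

lemma cross_swap (x y : ℂ) : cross y x = -cross x y := by simp only [cross]; ring

lemma cross_sq_of_tangent (hu : IsSpinor C₀ u C) (hv : IsSpinor C₀ v C')
    (h : ExternallyTangent C C') : (C₀.radius * cross u v) ^ 2 = 1 := by
  cases C with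
  | disc D => exact (externallyTangent_disc_iff hu hv).mp h
  | halfPlane n hn d =>
    cases C' with
    | disc E =>
      have := (externallyTangent_disc_iff hv hu).mp h.symm
      rw [cross_swap u v] at this
      linarith
    | halfPlane => exact h.elim

/-- The successor of `(C₀, C, C')` has the sum of the spinors as a spinor. -/
lemma exists_successor (hu : IsSpinor C₀ u C) (hv : IsSpinor C₀ v C')
    (hc : (C₀.radius * cross u v) ^ 2 = 1) (hd : 0 < dot u v) :
    ∃ S : RoundDisc, IsSpinor C₀ (u + v) (.disc S) ∧ IsSuccessor (.disc C₀) C C' S := by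
  have h0 := C₀.radius_pos
  have hk : 0 < C₀.radius⁻¹ := inv_pos.mpr h0
  have hs := normSq_add_eq u v
  have hu1 := hu.inv_radius_le
  have hv1 := hv.inv_radius_le
  -- The acute angle gives |u + v|² > |u|² + |v|², where both terms are at least 1/r₀. The same
  -- inequality later makes this curvature larger than those of `C₀`, `C` and `C'`.
  have hr : 0 < Complex.normSq (u + v) - C₀.radius⁻¹ := by linarith
  set r := (Complex.normSq (u + v) - C₀.radius⁻¹)⁻¹ with hrdef
  have hr0 : 0 < r := inv_pos.mpr hr
  let S : RoundDisc := ⟨C₀.center + ((C₀.radius * r : ℝ) : ℂ) * (u + v) ^ 2, r, hr0⟩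
  have hS : IsSpinor C₀ (u + v) (.disc S) := by
    refine ⟨?_, by simp [S]⟩
    simp only [ExternallyTangent, S, dist_self_add_right]
    rw [norm_mul, norm_pow, Complex.norm_real, Real.norm_of_nonneg (by positivity),
      Complex.sq_norm]
    have : Complex.normSq (u + v) = r⁻¹ + C₀.radius⁻¹ := by rw [hrdef, inv_inv]; ring
    rw [this]; field_simp
  have hcurv : (GenDisc.disc S).curvature = Complex.normSq (u + v) - C₀.radius⁻¹ := by
    simp [GenDisc.curvature, S, hrdef]
  have hcu := hu.normSq_eq
  have hcv := hv.normSq_eq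
  refine ⟨S, hS, ⟨hS.tangent.symm, ?_, ?_, ?_, ?_, ?_⟩⟩
  · rw [externallyTangent_disc_iff hS hu, ← hc]
    simp only [cross, Complex.add_re, Complex.add_im]; ring
  · rw [externallyTangent_disc_iff hS hv, ← hc]
    simp only [cross, Complex.add_re, Complex.add_im]; ring
  · rw [IsSmaller, hcurv]; simp only [GenDisc.curvature]; linarith
  · rw [IsSmaller, hcurv]; linarith
  · rw [IsSmaller, hcurv]; linarith

lemma IsSpinor.eq_or_eq_neg (hu : IsSpinor C₀ u C) (hv : IsSpinor C₀ v C) :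
    v = u ∨ v = -u := by
  have h0 : (C₀.radius : ℂ) ≠ 0 := by exact_mod_cast C₀.radius_pos.ne'
  have : v ^ 2 = u ^ 2 := by
    cases C with
    | disc D =>
      have h1 : ((C₀.radius * D.radius : ℝ) : ℂ) ≠ 0 := by
        exact_mod_cast (mul_pos C₀.radius_pos D.radius_pos).ne'
      exact mul_left_cancel₀ h1 (hv.2.symm.trans hu.2)
    | halfPlane n hn d => exact mul_left_cancel₀ h0 (hv.2.symm.trans hu.2)
  exact sq_eq_sq_iff_eq_or_eq_neg.mp this

lemma IsSpinor.centerVec_eq (hu : IsSpinor C₀ u C) :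
    ∃ c : ℝ, 0 < c ∧ centerVec C₀ C = c * u ^ 2 := by
  have h0 := C₀.radius_pos
  cases C with
  | disc D => exact ⟨_, mul_pos h0 D.radius_pos, hu.2⟩
  | halfPlane n hn d => exact ⟨_, h0, hu.2⟩

/-- The vector of length `ρ` in direction `t / 2`. -/
noncomputable def halfPolar (ρ t : ℝ) : ℂ := ⟨ρ * Real.cos (t / 2), ρ * Real.sin (t / 2)⟩

@[simp] lemma halfPolar_re (ρ t : ℝ) : (halfPolar ρ t).re = ρ * Real.cos (t / 2) := rfl
@[simp] lemma halfPolar_im (ρ t : ℝ) : (halfPolar ρ t).im = ρ * Real.sin (t / 2) := rfl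

lemma halfPolar_sq (ρ t : ℝ) :
    halfPolar ρ t ^ 2 = ((ρ ^ 2 : ℝ) : ℂ) * (Real.cos t + Real.sin t * Complex.I) := by
  have h : t = 2 * (t / 2) := by ring
  have hc : Real.cos t = Real.cos (t / 2) ^ 2 - Real.sin (t / 2) ^ 2 := by
    conv_lhs => rw [h, Real.cos_two_mul']
  have hs : Real.sin t = 2 * Real.sin (t / 2) * Real.cos (t / 2) := by
    conv_lhs => rw [h, Real.sin_two_mul]
  rw [hc, hs]
  apply Complex.ext <;> simp [pow_two, halfPolar, -Complex.ofReal_cos, -Complex.ofReal_sin] <;> ring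

lemma cross_halfPolar (ρ ρ' t t' : ℝ) :
    cross (halfPolar ρ t) (halfPolar ρ' t') = ρ * ρ' * Real.sin ((t' - t) / 2) := by
  rw [sub_div, Real.sin_sub]; simp [cross]; ring

lemma dot_halfPolar (ρ ρ' t t' : ℝ) :
    dot (halfPolar ρ t) (halfPolar ρ' t') = ρ * ρ' * Real.cos ((t' - t) / 2) := by
  rw [sub_div, Real.cos_sub]; simp [dot]; ring

lemma angle_eq_of_isSpinor {ρ t : ℝ} (hρ : 0 < ρ) (h : IsSpinor C₀ (halfPolar ρ t) C) :
    (t : Real.Angle) = angle C₀ C := by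
  obtain ⟨c, hc, he⟩ := h.centerVec_eq
  rw [angle, he, halfPolar_sq, ← mul_assoc, ← Complex.ofReal_mul]
  have := Complex.arg_mul_cos_add_sin_mul_I_coe_angle (r := c * ρ ^ 2) (by positivity)
    (t : Real.Angle)
  rw [← this, Real.Angle.cos_coe, Real.Angle.sin_coe]

/-- A real determination of the angle fixes the sign of the square root. Angles less than π apart
then have spinors at an acute angle. -/
lemma exists_isSpinor {a : ℝ} (ht : ExternallyTangent (.disc C₀) C)
    (ha : (a : Real.Angle) = angle C₀ C) :
    ∃ ρ : ℝ, 0 < ρ ∧ IsSpinor C₀ (halfPolar ρ a) C := by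
  have h0 := C₀.radius_pos
  have hpolar : centerVec C₀ C = ‖centerVec C₀ C‖ * (Real.cos a + Real.sin a * Complex.I) := by
    have h1 := Complex.norm_mul_cos_add_sin_mul_I (centerVec C₀ C)
    have h2 : Real.cos a = Real.cos (Complex.arg (centerVec C₀ C)) := by
      rw [← Real.Angle.cos_coe, ha, angle, Real.Angle.cos_coe]
    have h3 : Real.sin a = Real.sin (Complex.arg (centerVec C₀ C)) := by
      rw [← Real.Angle.sin_coe, ha, angle, Real.Angle.sin_coe]
    rw [h2, h3]
    push_cast
    exact h1.symm
  have aux : ∀ m : ℝ, 0 < m → 0 < ‖centerVec C₀ C‖ → ∃ ρ : ℝ, 0 < ρ ∧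
      centerVec C₀ C = (m : ℂ) * halfPolar ρ a ^ 2 := by
    intro m hm hn
    refine ⟨√(‖centerVec C₀ C‖ / m), by positivity, ?_⟩
    rw [halfPolar_sq, Real.sq_sqrt (by positivity), ← mul_assoc, ← Complex.ofReal_mul,
      mul_div_cancel₀ _ hm.ne']
    exact hpolar
  cases C with
  | disc D =>
    have h1 := D.radius_pos
    obtain ⟨ρ, hρ, h⟩ := aux (C₀.radius * D.radius) (by positivity) (by
      have h2 := ht
      simp only [ExternallyTangent, dist_comm C₀.center, dist_eq_norm] at h2
      simp only [centerVec, h2]; positivity)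
    exact ⟨ρ, hρ, ht, h⟩
  | halfPlane n hn d =>
    obtain ⟨ρ, hρ, h⟩ := aux C₀.radius h0 (by simp only [centerVec, hn]; norm_num)
    exact ⟨ρ, hρ, ht, h⟩

/-- The sum of two vectors has an intermediate direction. -/
lemma exists_halfPolar_add {ρ ρ' t t' : ℝ} (hρ : 0 < ρ) (hρ' : 0 < ρ') (h : |t - t'| < Real.pi) :
    ∃ s ∈ uIcc t t', ∃ σ : ℝ, 0 < σ ∧ halfPolar ρ t + halfPolar ρ' t' = halfPolar σ s := by
  -- The function is the component of the sum orthogonal to direction s/2; it takes values of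
  -- opposite sign (or zero) at the two ends.
  obtain ⟨s, hs, hs0⟩ : (0 : ℝ) ∈
      (fun s => ρ * Real.sin ((t - s) / 2) + ρ' * Real.sin ((t' - s) / 2)) '' uIcc t t' := by
    apply intermediate_value_uIcc
    · fun_prop
    · have e : Real.sin ((t - t') / 2) = -Real.sin ((t' - t) / 2) := by
        rw [← Real.sin_neg]; congr 1; ring
      simp only [sub_self, zero_div, Real.sin_zero, mul_zero, zero_add, add_zero, e]
      rw [mem_uIcc]
      rcases le_total 0 (Real.sin ((t' - t) / 2)) with h | h
      · right; constructor <;> nlinarith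
      · left; constructor <;> nlinarith
  have hsub : ∀ x ∈ uIcc t t', |x - s| < Real.pi := fun x hx => by
    have h1 := abs_sub_le_of_uIcc_subset_uIcc (uIcc_subset_uIcc hs hx)
    rw [abs_sub_comm t' t] at h1
    exact h1.trans_lt h
  have hcos : ∀ x ∈ uIcc t t', 0 < Real.cos ((x - s) / 2) := fun x hx => by
    obtain ⟨h1, h2⟩ := abs_lt.mp (hsub x hx)
    exact Real.cos_pos_of_mem_Ioo ⟨by linarith, by linarith⟩
  have h1 := hcos t left_mem_uIcc
  have h2 := hcos t' right_mem_uIcc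
  refine ⟨s, hs, ρ * Real.cos ((t - s) / 2) + ρ' * Real.cos ((t' - s) / 2), by positivity, ?_⟩
  simp only at hs0
  have hc := Real.sin_sq_add_cos_sq (s / 2)
  simp only [sub_div, Real.sin_sub, Real.cos_sub] at hs0 ⊢
  apply Complex.ext
  · simp only [Complex.add_re, halfPolar_re]
    linear_combination (-(ρ * Real.cos (t / 2) + ρ' * Real.cos (t' / 2))) * hc +
      Real.sin (s / 2) * (-1) * hs0
  · simp only [Complex.add_im, halfPolar_im]
    linear_combination (-(ρ * Real.sin (t / 2) + ρ' * Real.sin (t' / 2))) * hc +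
      Real.cos (s / 2) * hs0

end Spinors

/-! ### Apollonian curves as affine images of the model curve -/

lemma normSq_halfPolar (ρ t : ℝ) : Complex.normSq (halfPolar ρ t) = ρ ^ 2 := by
  simp only [Complex.normSq_apply, halfPolar_re, halfPolar_im]
  linear_combination ρ ^ 2 * Real.sin_sq_add_cos_sq (t / 2)

/-- Cutting a corner in the frame of the arc (u, v) yields the frame of the subarc (u, u + v) with a
third of the chord factor. `frame_cutRight` is the counterpart for (u + v, v), starting at the
intermediate point. -/
lemma frame_cutLeft (p u v lam : ℂ) (z : ℂ) :
    frame (p - lam * u) (lam * u) (-(lam * v)) (cutLeft z) =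
      frame (p - lam / 3 * u) (lam / 3 * u) (-(lam / 3 * (u + v))) z := by
  simp only [frame, cutLeft_re, cutLeft_im]; push_cast; ring

lemma frame_cutRight (p u v lam : ℂ) (z : ℂ) :
    frame (p - lam * u) (lam * u) (-(lam * v)) (cutRight z) =
      frame (p - lam / 3 * (2 * u + v) - lam / 3 * (u + v)) (lam / 3 * (u + v))
        (-(lam / 3 * v)) z := by
  simp only [frame, cutRight_re, cutRight_im]; push_cast; ring

lemma frame_one (O x y : ℂ) : frame O x y 1 = O + x := by simp [frame]

lemma frame_I (O x y : ℂ) : frame O x y Complex.I = O + y := by simp [frame]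

namespace ApollonianCurve

variable {C₀ : RoundDisc} {C₁ C₂ : GenDisc} {g : ApollonianCurve C₀ C₁ C₂}
  {ρ t ρ' t' lam : ℝ}

/-- The part of an Apollonian curve between the angles `t` and `t'` of two tangent members of the
family of circles, with spinors `halfPolar ρ t` and `halfPolar ρ' t'`. The factor `lam` measures
the chord. -/
structure IsSubarc (g : ApollonianCurve C₀ C₁ C₂) (ρ t ρ' t' lam : ℝ) : Prop where
  mem_left : t ∈ uIcc g.a g.b
  mem_right : t' ∈ uIcc g.a g.b
  left_pos : 0 < ρ
  right_pos : 0 < ρ'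
  exists_circles : ∃ C C' : GenDisc, Family C₀ C₁ C₂ C ∧ Family C₀ C₁ C₂ C' ∧
    ExternallyTangent C C' ∧ IsSpinor C₀ (halfPolar ρ t) C ∧ IsSpinor C₀ (halfPolar ρ' t') C'
  sub_eq : g.γ t - g.γ t' = lam * (halfPolar ρ t + halfPolar ρ' t')

lemma abs_sub_lt (ht : t ∈ uIcc g.a g.b) (ht' : t' ∈ uIcc g.a g.b) : |t - t'| < Real.pi := by
  have h1 := abs_sub_le_of_uIcc_subset_uIcc (uIcc_subset_uIcc ht' ht)
  exact h1.trans_lt g.length_lt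

lemma dot_pos (hρ : 0 < ρ) (hρ' : 0 < ρ') (ht : t ∈ uIcc g.a g.b) (ht' : t' ∈ uIcc g.a g.b) :
    0 < dot (halfPolar ρ t) (halfPolar ρ' t') := by
  rw [dot_halfPolar]
  obtain ⟨h1, h2⟩ := abs_lt.mp (abs_sub_lt ht' ht)
  have := Real.cos_pos_of_mem_Ioo (x := (t' - t) / 2) ⟨by linarith, by linarith⟩
  positivity

/-- The increment of an Apollonian curve between tangent circles. -/
lemma exists_sub_eq {C C' : GenDisc} (hρ : 0 < ρ) (hρ' : 0 < ρ') (ht : t ∈ uIcc g.a g.b)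
    (ht' : t' ∈ uIcc g.a g.b) (hC : Family C₀ C₁ C₂ C) (hC' : Family C₀ C₁ C₂ C')
    (hCC' : ExternallyTangent C C') (hu : IsSpinor C₀ (halfPolar ρ t) C)
    (hv : IsSpinor C₀ (halfPolar ρ' t') C') :
    ∃ lam : ℝ, g.γ t - g.γ t' = lam * (halfPolar ρ t + halfPolar ρ' t') := by
  obtain ⟨S, hS, hsucc⟩ := exists_successor hu hv (cross_sq_of_tangent hu hv hCC')
    (dot_pos hρ hρ' ht ht')
  obtain ⟨w, hw, τ, hτ⟩ := g.sub_mem C C' hC hC' hCC' S hsucc t ht t' ht'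
    (angle_eq_of_isSpinor hρ hu) (angle_eq_of_isSpinor hρ' hv)
  have hr : 0 ≤ C₀.radius * S.radius := (mul_pos C₀.radius_pos S.radius_pos).le
  have hsq : ((C₀.radius * S.radius : ℝ) : ℂ) = ((√(C₀.radius * S.radius) : ℝ) : ℂ) ^ 2 := by
    rw [← Complex.ofReal_pow, Real.sq_sqrt hr]
  rw [hS.2, hsq, ← mul_pow] at hw
  -- The square root in `sqrtLine` is known only up to sign, which the real factor absorbs.
  rcases sq_eq_sq_iff_eq_or_eq_neg.mp hw with rfl | rfl
  · exact ⟨τ * √(C₀.radius * S.radius), by rw [hτ]; push_cast; ring⟩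
  · exact ⟨-(τ * √(C₀.radius * S.radius)), by rw [hτ]; push_cast; ring⟩

/-- A subarc splits into two subarcs whose chord factors are a third of its own. -/
lemma IsSubarc.split (h : g.IsSubarc ρ t ρ' t' lam) :
    ∃ s ∈ uIcc t t', ∃ σ : ℝ, halfPolar ρ t + halfPolar ρ' t' = halfPolar σ s ∧
      g.IsSubarc ρ t σ s (lam / 3) ∧ g.IsSubarc σ s ρ' t' (lam / 3) := by
  obtain ⟨C, C', hC, hC', hCC', hu, hv⟩ := h.exists_circles
  have ht := h.mem_left
  have ht' := h.mem_right
  have hρ := h.left_pos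
  have hρ' := h.right_pos
  have hcr := cross_sq_of_tangent hu hv hCC'
  have hd := dot_pos hρ hρ' ht ht'
  obtain ⟨s, hs, σ, hσ, hsum⟩ := exists_halfPolar_add hρ hρ' (abs_sub_lt ht ht')
  have hs' : s ∈ uIcc g.a g.b := uIcc_subset_uIcc ht ht' hs
  obtain ⟨S, hS, hsucc⟩ := exists_successor hu hv hcr hd
  have hSF : Family C₀ C₁ C₂ (.disc S) := Family.succ hC hC' hCC' hsucc
  have hS' := hS
  rw [hsum] at hS'
  obtain ⟨α, hα⟩ := exists_sub_eq (g := g) hρ hσ ht hs' hC hSF hsucc.tangent₂.symm hu hS'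
  obtain ⟨β, hβ⟩ := exists_sub_eq (g := g) hσ hρ' hs' ht' hSF hC' hsucc.tangent₃ hS' hv
  have hne : cross (halfPolar ρ t) (halfPolar ρ' t') ≠ 0 := by
    intro h0; rw [h0] at hcr; norm_num at hcr
  have heq := h.sub_eq
  rw [← sub_add_sub_cancel _ (g.γ s), hα, hβ, ← hsum] at heq
  set u := halfPolar ρ t
  set v := halfPolar ρ' t'
  have e1 := congrArg Complex.re heq
  have e2 := congrArg Complex.im heq
  simp only [Complex.add_re, Complex.add_im, Complex.mul_re, Complex.mul_im, Complex.ofReal_re,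
    Complex.ofReal_im, zero_mul, sub_zero, add_zero] at e1 e2
  -- Coefficients of u and v in λ(u + v) = α(2u + v) + β(u + 2v), extracted by Cramer's rule.
  have c1 : 2 * α + β = lam := by
    apply mul_right_cancel₀ hne
    simp only [cross]; linear_combination v.im * e1 - v.re * e2
  have c2 : α + 2 * β = lam := by
    apply mul_right_cancel₀ hne
    simp only [cross]; linear_combination u.re * e2 - u.im * e1
  have hα3 : α = lam / 3 := by linarith
  have hβ3 : β = lam / 3 := by linarith
  rw [hα3] at hα
  rw [hβ3] at hβ
  refine ⟨s, hs, σ, hsum, ⟨ht, hs', hρ, hσ, ⟨C, _, hC, hSF, hsucc.tangent₂.symm, ?_, ?_⟩, ?_⟩,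
    ⟨hs', ht', hσ, hρ', ⟨_, C', hSF, hC', hsucc.tangent₃, ?_, ?_⟩, ?_⟩⟩ <;>
  assumption

/-- The affine map carrying `modelCurve` to a subarc. -/
noncomputable def subarcFrame (g : ApollonianCurve C₀ C₁ C₂) (ρ t ρ' t' lam : ℝ) (z : ℂ) : ℂ :=
  frame (g.γ t - lam * halfPolar ρ t) (lam * halfPolar ρ t) (-(lam * halfPolar ρ' t')) z

lemma subarcFrame_cutLeft {σ s : ℝ} (hsum : halfPolar ρ t + halfPolar ρ' t' = halfPolar σ s)
    (z : ℂ) :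
    subarcFrame g ρ t ρ' t' lam (cutLeft z) = subarcFrame g ρ t σ s (lam / 3) z := by
  simp only [subarcFrame, frame_cutLeft, hsum]; push_cast; rfl

lemma subarcFrame_cutRight {σ s : ℝ} (hsum : halfPolar ρ t + halfPolar ρ' t' = halfPolar σ s)
    (h : g.IsSubarc ρ t σ s (lam / 3)) (z : ℂ) :
    subarcFrame g ρ t ρ' t' lam (cutRight z) = subarcFrame g σ s ρ' t' (lam / 3) z := by
  have h1 := h.sub_eq
  have h2 : g.γ s = g.γ t - (lam / 3 : ℂ) * (2 * halfPolar ρ t + halfPolar ρ' t') := by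
    rw [← hsum] at h1
    push_cast at h1
    linear_combination -h1
  simp only [subarcFrame, frame_cutRight, hsum, h2]; push_cast; rfl

lemma IsSubarc.frame_one_eq : subarcFrame g ρ t ρ' t' lam 1 = g.γ t := by
  rw [subarcFrame, frame_one]; ring

lemma IsSubarc.frame_I_eq (h : g.IsSubarc ρ t ρ' t' lam) :
    subarcFrame g ρ t ρ' t' lam Complex.I = g.γ t' := by
  rw [subarcFrame, frame_I]; linear_combination h.sub_eq

lemma IsSubarc.vertex_mem {z : ℂ} (hz : IsCurveVertex z) (h : g.IsSubarc ρ t ρ' t' lam) :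
    subarcFrame g ρ t ρ' t' lam z ∈ g.image := by
  induction hz generalizing ρ t ρ' t' lam with
  | one => exact ⟨t, h.mem_left, IsSubarc.frame_one_eq.symm⟩
  | I => exact ⟨t', h.mem_right, h.frame_I_eq.symm⟩
  | left _ ih =>
    obtain ⟨s, -, σ, hsum, h1, h2⟩ := h.split
    rw [subarcFrame_cutLeft hsum]
    exact ih h1
  | right _ ih =>
    obtain ⟨s, -, σ, hsum, h1, h2⟩ := h.split
    rw [subarcFrame_cutRight hsum h1]
    exact ih h2

/-- Every angle lies in subarcs with long spinors, which start at images of vertices. -/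
lemma IsSubarc.exists_vertex (n : ℕ) {x : ℝ} (h : g.IsSubarc ρ t ρ' t' lam)
    (hx : x ∈ uIcc t t') {m : ℝ}
    (hm : C₀.radius⁻¹ * m ≤ ρ ^ 2 + ρ' ^ 2) :
    ∃ ρ₁ t₁ ρ₁' t₁' lam₁ : ℝ, g.IsSubarc ρ₁ t₁ ρ₁' t₁' lam₁ ∧ x ∈ uIcc t₁ t₁' ∧
      C₀.radius⁻¹ * (m + n) ≤ ρ₁ ^ 2 + ρ₁' ^ 2 ∧
      ∃ z, IsCurveVertex z ∧ subarcFrame g ρ t ρ' t' lam z = g.γ t₁ := by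
  induction n generalizing ρ t ρ' t' lam m with
  | zero =>
    exact ⟨ρ, t, ρ', t', lam, h, hx, by simpa using hm, 1, IsCurveVertex.one,
      IsSubarc.frame_one_eq⟩
  | succ n ih =>
    obtain ⟨s, hs, σ, hsum, h1, h2⟩ := h.split
    obtain ⟨C, C', hC, hC', hCC', hu, hv⟩ := h.exists_circles
    have hd := dot_pos h.left_pos h.right_pos h.mem_left h.mem_right
    have hσ : σ ^ 2 = ρ ^ 2 + ρ' ^ 2 + 2 * dot (halfPolar ρ t) (halfPolar ρ' t') := by
      have := normSq_add_eq (halfPolar ρ t) (halfPolar ρ' t')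
      simpa only [hsum, normSq_halfPolar] using this
    have hρ := hu.inv_radius_le
    have hρ' := hv.inv_radius_le
    rw [normSq_halfPolar] at hρ hρ'
    -- In either half, replacing one spinor by the sum raises the total squared length by at least
    -- 1/r₀, hence `m + 1`.
    rcases uIcc_subset_uIcc_union_uIcc (b := s) hx with hx | hx
    · obtain ⟨ρ₁, t₁, ρ₁', t₁', lam₁, h3, h4, h5, z, hz, h6⟩ :=
        ih h1 hx (m := m + 1) (by linarith)
      refine ⟨ρ₁, t₁, ρ₁', t₁', lam₁, h3, h4, ?_, _, hz.left, ?_⟩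
      · push_cast; linarith
      · rw [subarcFrame_cutLeft hsum, h6]
    · obtain ⟨ρ₁, t₁, ρ₁', t₁', lam₁, h3, h4, h5, z, hz, h6⟩ :=
        ih h2 hx (m := m + 1) (by linarith)
      refine ⟨ρ₁, t₁, ρ₁', t₁', lam₁, h3, h4, ?_, _, hz.right, ?_⟩
      · push_cast; linarith
      · rw [subarcFrame_cutRight hsum h1, h6]

/-- Subarcs with long spinors are short. -/
lemma IsSubarc.width_sq_le (h : g.IsSubarc ρ t ρ' t' lam) {n : ℝ} (hn : 0 < n)
    (hm : C₀.radius⁻¹ * n ≤ ρ ^ 2 + ρ' ^ 2) : (t - t') ^ 2 ≤ 2 * Real.pi ^ 2 / n := by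
  obtain ⟨C, C', hC, hC', hCC', hu, hv⟩ := h.exists_circles
  have hcr := cross_sq_of_tangent hu hv hCC'
  have hρ := hu.inv_radius_le
  have hρ' := hv.inv_radius_le
  rw [normSq_halfPolar] at hρ hρ'
  rw [cross_halfPolar] at hcr
  have hr := C₀.radius_pos
  have hpi := Real.pi_pos
  have hw := abs_sub_lt h.mem_right h.mem_left
  have hsin : (t' - t) ^ 2 ≤ Real.pi ^ 2 * Real.sin ((t' - t) / 2) ^ 2 := by
    have h1 := Real.mul_abs_le_abs_sin (x := (t' - t) / 2) (by
      rw [abs_div, abs_two]; linarith)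
    rw [abs_div, abs_two] at h1
    have h2 : |t' - t| ≤ Real.pi * |Real.sin ((t' - t) / 2)| := by
      calc |t' - t| = Real.pi * (2 / Real.pi * (|t' - t| / 2)) := by field_simp
        _ ≤ _ := by gcongr
    rw [← sq_abs (t' - t), ← sq_abs (Real.sin _), ← mul_pow]
    gcongr
  set k := C₀.radius⁻¹ with hk
  have hk0 : 0 < k := inv_pos.mpr hr
  -- The larger factor is at least kn/2 and the other at least k. As tangency fixes ρρ'|sin((t' −
  -- t)/2)| = k, long spinors force a small angle.
  have hprod : k * (k * n) / 2 ≤ ρ ^ 2 * ρ' ^ 2 := by nlinarith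
  have hcr' : ρ ^ 2 * ρ' ^ 2 * Real.sin ((t' - t) / 2) ^ 2 = k ^ 2 := by
    rw [hk]; field_simp; linarith
  have hs : Real.sin ((t' - t) / 2) ^ 2 ≤ 2 / n := by
    rw [le_div_iff₀ hn]
    have h3 : k * (k * n) / 2 * Real.sin ((t' - t) / 2) ^ 2 ≤ k ^ 2 := by
      rw [← hcr']; gcongr
    have hk2 : 0 < k ^ 2 := by positivity
    apply le_of_mul_le_mul_left _ hk2
    linarith
  calc (t - t') ^ 2 = (t' - t) ^ 2 := by ring
    _ ≤ Real.pi ^ 2 * (2 / n) := hsin.trans (by gcongr)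
    _ = _ := by ring

lemma isCompact_image (g : ApollonianCurve C₀ C₁ C₂) : IsCompact g.image :=
  isCompact_uIcc.image_of_continuousOn g.continuousOn

/-- An Apollonian curve is an affine image of the model curve. -/
lemma IsSubarc.image_eq (h : g.IsSubarc ρ g.a ρ' g.b lam) :
    g.image = subarcFrame g ρ g.a ρ' g.b lam '' modelCurve := by
  have hcont : Continuous (subarcFrame g ρ g.a ρ' g.b lam) := continuous_frame _ _ _
  apply subset_antisymm
  · rintro _ ⟨x, hx, rfl⟩
    have hm : C₀.radius⁻¹ * 0 ≤ ρ ^ 2 + ρ' ^ 2 := by rw [mul_zero]; positivity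
    -- Subarcs around x with widths tending to 0: the curve values at their left ends are images of
    -- vertices and converge to γ(x). Using `n + 1` keeps the width bound free of division by zero.
    choose ρ₁ t₁ ρ₁' t₁' lam₁ h1 h2 h3 z hz h4 using
      fun n : ℕ => h.exists_vertex (n + 1) hx hm
    have hlim : Filter.Tendsto t₁ Filter.atTop (nhdsWithin x (uIcc g.a g.b)) := by
      refine tendsto_nhdsWithin_iff.mpr ⟨?_, Filter.Eventually.of_forall fun n => (h1 n).mem_left⟩
      rw [tendsto_iff_dist_tendsto_zero]
      have hsq : Filter.Tendsto (fun n : ℕ => √(2 * Real.pi ^ 2 / ((n : ℝ) + 1)))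
          Filter.atTop (nhds 0) := by
        rw [← Real.sqrt_zero]
        refine (Real.continuous_sqrt.tendsto 0).comp ?_
        exact tendsto_const_nhds.div_atTop
          (Filter.tendsto_atTop_add_const_right _ _ tendsto_natCast_atTop_atTop)
      refine squeeze_zero (fun n => dist_nonneg) (fun n => ?_) hsq
      apply Real.le_sqrt_of_sq_le
      have hw := (h1 n).width_sq_le (n := (n : ℝ) + 1) (by positivity) (by
        have := h3 n; push_cast at this; simpa using this)
      have h5 : dist (t₁ n) x ≤ |t₁ n - t₁' n| := by
        rw [Real.dist_eq, abs_sub_comm, abs_sub_comm (t₁ n)]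
        exact abs_sub_left_of_mem_uIcc (h2 n)
      calc dist (t₁ n) x ^ 2 ≤ |t₁ n - t₁' n| ^ 2 := by gcongr
        _ = _ := sq_abs _
        _ ≤ _ := hw
    have hγ := (g.continuousOn x hx).tendsto.comp hlim
    refine (isCompact_modelCurve.image hcont).isClosed.mem_of_tendsto hγ
      (Filter.Eventually.of_forall fun n => ⟨z n, subset_closure (hz n), h4 n⟩)
  · rw [image_subset_iff]
    refine closure_minimal (fun z hz => h.vertex_mem hz) ?_
    exact g.isCompact_image.isClosed.preimage hcont

/-- An Apollonian curve in terms of the spinors of the two circles. -/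
lemma exists_frame (g : ApollonianCurve C₀ C₁ C₂) (h1 : ExternallyTangent (.disc C₀) C₁)
    (h2 : ExternallyTangent (.disc C₀) C₂) (h12 : ExternallyTangent C₁ C₂) :
    ∃ (u v : ℂ) (lam : ℝ), IsSpinor C₀ u C₁ ∧ IsSpinor C₀ v C₂ ∧ 0 < dot u v ∧
      g.source - g.target = lam * (u + v) ∧
      g.image = frame (g.source - lam * u) (lam * u) (-(lam * v)) '' modelCurve := by
  obtain ⟨ρ, hρ, hu⟩ := exists_isSpinor h1 g.angle_a
  obtain ⟨ρ', hρ', hv⟩ := exists_isSpinor h2 g.angle_b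
  obtain ⟨lam, hlam⟩ := exists_sub_eq hρ hρ' left_mem_uIcc right_mem_uIcc Family.left
    Family.right h12 hu hv
  have h : g.IsSubarc ρ g.a ρ' g.b lam :=
    ⟨left_mem_uIcc, right_mem_uIcc, hρ, hρ', ⟨_, _, .left, .right, h12, hu, hv⟩, hlam⟩
  exact ⟨_, _, lam, hu, hv, dot_pos hρ hρ' left_mem_uIcc right_mem_uIcc, hlam, h.image_eq⟩

end ApollonianCurve

/-! ### Regions enclosed by star-shaped curves -/

/-- The union of the segments from `O` to the points of `K`. -/
def starHull (O : ℂ) (K : Set ℂ) : Set ℂ :=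
  (fun p : ℝ × ℂ => O + p.1 * (p.2 - O)) '' (Icc 0 1 ×ˢ K)

lemma isCompact_starHull {O : ℂ} {K : Set ℂ} (hK : IsCompact K) : IsCompact (starHull O K) :=
  (isCompact_Icc.prod hK).image (by fun_prop)

/-- For `O ∉ K` these are the points on or beyond `K` as seen from `O`. The set is a projection
along a compact factor, hence closed. -/
lemma isClosed_shadow {O : ℂ} {K : Set ℂ} (hK : IsClosed K) :
    IsClosed {z : ℂ | ∃ τ ∈ Icc (0 : ℝ) 1, O + τ * (z - O) ∈ K} := by
  have h := isClosedMap_snd_of_compactSpace (X := Icc (0 : ℝ) 1) (Y := ℂ)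
    {p | O + ((p.1 : ℝ) : ℂ) * (p.2 - O) ∈ K} (hK.preimage (by fun_prop))
  convert h using 1
  ext z
  simp

/-- A compact set that meets each ray from `O` exactly once encloses the star-shaped region
it bounds. -/
lemma enclosedRegion_eq_starHull_diff {O : ℂ} {K : Set ℂ} (hK : IsCompact K) (hO : O ∉ K)
    (hray : ∀ z : ℂ, z ≠ 0 → ∃ s : ℝ, 0 < s ∧ O + s * z ∈ K)
    (huniq : ∀ (z : ℂ) (s s' : ℝ), 0 < s → 0 < s' → O + s * z ∈ K → O + s' * z ∈ K → s = s') :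
    enclosedRegion K = starHull O K \ K := by
  set outer := {z : ℂ | ∃ τ ∈ Icc (0 : ℝ) 1, O + τ * (z - O) ∈ K} with houter
  have hstar := isCompact_starHull (O := O) hK
  have hcl : IsClosed outer := isClosed_shadow hK.isClosed
  have hmem : ∀ z, z ∈ K → z ∈ outer := fun z hz => ⟨1, by simp, by simpa using hz⟩
  have hcover : ∀ z, z ∈ starHull O K ∨ z ∈ outer := by
    intro z
    by_cases hz : z = O
    · obtain ⟨s, hs, hk⟩ := hray 1 one_ne_zero
      exact Or.inl ⟨(0, _), ⟨by simp, hk⟩, by simp [hz]⟩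
    · obtain ⟨s, hs, hk⟩ := hray (z - O) (sub_ne_zero.mpr hz)
      rcases le_total s 1 with h | h
      · exact Or.inr ⟨s, ⟨hs.le, h⟩, hk⟩
      · refine Or.inl ⟨(s⁻¹, _), ⟨⟨by positivity, inv_le_one_of_one_le₀ h⟩, hk⟩, ?_⟩
        have : (s : ℂ) ≠ 0 := by exact_mod_cast hs.ne'
        simp only [Complex.ofReal_inv]
        field_simp
        ring
  have hinter : ∀ z, z ∈ starHull O K → z ∈ outer → z ∈ K := by
    rintro _ ⟨⟨s, k⟩, ⟨⟨hs0, hs1⟩, hk⟩, rfl⟩ ⟨τ, ⟨hτ0, hτ1⟩, hτ⟩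
    simp only at hs0 hs1 hk hτ ⊢
    rcases hs0.eq_or_lt with rfl | hs0
    · simp [hO] at hτ
    rcases hτ0.eq_or_lt with rfl | hτ0
    · simp [hO] at hτ
    have h1 := huniq (k - O) 1 (τ * s) one_pos (by positivity) (by simpa using hk) (by
      convert hτ using 1; push_cast; ring)
    have h2 : s = 1 := by nlinarith
    simpa [h2] using hk
  ext z
  constructor
  · rintro ⟨hzK, hb⟩
    refine ⟨?_, hzK⟩
    by_contra hz
    obtain ⟨τ, ⟨hτ0, hτ1⟩, hτ⟩ := (hcover z).resolve_left hz
    rcases hτ0.eq_or_lt with rfl | hτ0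
    · simp [hO] at hτ
    have hzO : z - O ≠ 0 := by
      intro h
      rw [h] at hτ
      simp [hO] at hτ
    have hne : τ < 1 := by
      refine lt_of_le_of_ne hτ1 ?_
      rintro rfl
      exact hzK (by simpa using hτ)
    -- A point beyond `K` can escape to infinity along its ray, which has already met `K` once.
    have hsub : (fun s : ℝ => O + s * (z - O)) '' Ici 1 ⊆ connectedComponentIn Kᶜ z := by
      refine IsPreconnected.subset_connectedComponentIn
        (isPreconnected_Ici.image _ (by fun_prop)) ⟨1, self_mem_Ici, by simp⟩ ?_
      rintro _ ⟨s, hs, rfl⟩ hsK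
      have hs : 1 ≤ s := hs
      have := huniq (z - O) s τ (by linarith) hτ0 hsK hτ
      linarith
    obtain ⟨R, hR⟩ := (hb.subset hsub).exists_norm_le
    have hpos : 0 < ‖z - O‖ := norm_pos_iff.mpr hzO
    have h1 : 1 ≤ 1 + (|R| + ‖O‖) / ‖z - O‖ := by
      have : 0 ≤ (|R| + ‖O‖) / ‖z - O‖ := by positivity
      linarith
    have h2 := hR _ ⟨1 + (|R| + ‖O‖) / ‖z - O‖, h1, rfl⟩
    have h3 := norm_sub_le_norm_add (((1 + (|R| + ‖O‖) / ‖z - O‖ : ℝ) : ℂ) * (z - O)) O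
    rw [add_comm _ O] at h3
    have h4 : ‖((1 + (|R| + ‖O‖) / ‖z - O‖ : ℝ) : ℂ) * (z - O)‖ = ‖z - O‖ + |R| + ‖O‖ := by
      rw [norm_mul, Complex.norm_real, Real.norm_of_nonneg (by linarith)]
      field_simp
      ring
    rw [h4] at h3
    have h5 := le_abs_self R
    simp only at h2
    linarith
  · rintro ⟨hz, hzK⟩
    refine ⟨hzK, hstar.isBounded.subset ?_⟩
    -- Off `K`, the open sets `outerᶜ` and `(starHull O K)ᶜ` are disjoint and cover, so the
    -- component stays on one side.
    have hsub : connectedComponentIn Kᶜ z ⊆ outerᶜ := by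
      refine IsPreconnected.subset_left_of_subset_union hcl.isOpen_compl
        hstar.isClosed.isOpen_compl ?_ ?_ ?_ isPreconnected_connectedComponentIn
      · rw [disjoint_left]
        intro w h1 h2
        exact (hcover w).elim h2 h1
      · intro w hw
        by_contra hc
        simp only [mem_union, mem_compl_iff, not_or, not_not] at hc
        exact connectedComponentIn_subset _ _ hw (hinter w hc.2 hc.1)
      · exact ⟨z, mem_connectedComponentIn hzK, fun h => hzK (hinter z hz h)⟩
    intro w hw
    exact (hcover w).resolve_right (hsub hw)

/-- Serves the degenerate triangle whose three curves are constant. -/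
lemma enclosedRegion_singleton (p : ℂ) : enclosedRegion {p} = ∅ := by
  rw [eq_empty_iff_forall_notMem]
  rintro z ⟨hz, hb⟩
  have hconn : IsPreconnected ({p}ᶜ : Set ℂ) :=
    (isConnected_compl_singleton_of_one_lt_rank (by simp [Complex.rank_real_complex]) p).isPreconnected
  rw [hconn.connectedComponentIn hz] at hb
  have : Bornology.IsBounded (univ : Set ℂ) := by
    rw [← compl_union_self {p}]
    exact hb.union Bornology.isBounded_singleton
  exact NormedSpace.unbounded_univ ℝ ℂ this

/-! ### Three model curves around a common center -/

lemma coeff_eq_zero {x y : ℂ} (h : cross x y ≠ 0) {a b : ℝ} (hab : (a * x + b * y : ℂ) = 0) :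
    a = 0 ∧ b = 0 := by
  have e1 := congrArg Complex.re hab
  have e2 := congrArg Complex.im hab
  simp at e1 e2
  constructor <;> apply mul_right_cancel₀ h <;> simp only [cross]
  · linear_combination y.im * e1 - y.re * e2
  · linear_combination x.re * e2 - x.im * e1

lemma exists_coeff {x y : ℂ} (h : cross x y ≠ 0) (w : ℂ) :
    w = ((cross w y / cross x y : ℝ) : ℂ) * x + ((cross x w / cross x y : ℝ) : ℂ) * y := by
  apply Complex.ext <;> simp <;> field_simp <;> simp only [cross] <;> ring

lemma isPreconnected_modelCurve_of_frame {O x y : ℂ} (h : cross x y ≠ 0)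
    (hc : IsPreconnected (frame O x y '' modelCurve)) : IsPreconnected modelCurve := by
  let inv : ℂ → ℂ := fun w => ((cross (w - O) y / cross x y : ℝ) : ℂ) +
    ((cross x (w - O) / cross x y : ℝ) : ℂ) * Complex.I
  have hinv : Continuous inv := by
    simp only [inv, cross]; fun_prop
  have hleft : ∀ z, inv (frame O x y z) = z := by
    intro z
    apply Complex.ext <;> simp [inv, frame] <;> field_simp <;> simp [cross] <;> ring
  have := hc.image inv hinv.continuousOn
  rwa [image_image, image_congr (fun z _ => hleft z), image_id'] at this

/-- A ray meets the model curve in a frame at most once. -/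
lemma arc_ray_unique {x y : ℂ} (h : cross x y ≠ 0) {k l : ℂ} (hk : k ∈ modelCurve)
    (hl : l ∈ modelCurve) {s s' : ℝ} (hs' : 0 < s')
    (he : (s * (k.re * x + k.im * y) : ℂ) = s' * (l.re * x + l.im * y)) : s = s' := by
  obtain ⟨h1, h2⟩ := coeff_eq_zero h (a := s * k.re - s' * l.re) (b := s * k.im - s' * l.im) (by
    push_cast; linear_combination he)
  have e : (s / s') • k = l := by
    apply Complex.ext <;> simp <;> field_simp <;> linarith
  have := ray_unique hk (s := s / s') (by rwa [e])
  rwa [div_eq_one_iff_eq hs'.ne'] at this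

/-- Model curves in adjacent sectors only have the common endpoint on a common ray. -/
lemma adjacent_ray_unique {x y z : ℂ} (h : cross x y ≠ 0) (hz : x + y + z = 0) {k l : ℂ}
    (hk : k ∈ modelCurve) (hl : l ∈ modelCurve) {s s' : ℝ} (hs : 0 < s) (hs' : 0 < s')
    (he : (s * (k.re * x + k.im * y) : ℂ) = s' * (l.re * y + l.im * z)) : s = s' := by
  obtain rfl : z = -(x + y) := by linear_combination hz
  obtain ⟨h1, h2⟩ := coeff_eq_zero h (a := s * k.re + s' * l.im)
    (b := s * k.im - s' * l.re + s' * l.im) (by push_cast; linear_combination he)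
  obtain ⟨h3, -, -⟩ := modelCurve_subset hk
  obtain ⟨-, h4, -⟩ := modelCurve_subset hl
  -- Two nonnegative terms add to zero, so both curve points sit at the tip of the shared edge y.
  have hk0 : k.re = 0 := by
    have := mul_nonneg hs'.le h4
    have := mul_nonneg hs.le h3
    exact (mul_eq_zero.mp (by linarith : s * k.re = 0)).resolve_left hs.ne'
  have hl0 : l.im = 0 := by
    have := mul_nonneg hs'.le h4
    have := mul_nonneg hs.le h3
    exact (mul_eq_zero.mp (by linarith : s' * l.im = 0)).resolve_left hs'.ne'
  rw [eq_I_of_re_eq_zero hk hk0, eq_one_of_im_eq_zero hl hl0] at h2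
  simp at h2
  linarith

lemma cross_rotate {x y z : ℂ} (hz : x + y + z = 0) : cross y z = cross x y := by
  obtain rfl : z = -(x + y) := by linear_combination hz
  simp [cross]; ring

/-- Three vectors with sum zero span three sectors that cover the plane. -/
lemma exists_sector {x y z : ℂ} (h : cross x y ≠ 0) (hz : x + y + z = 0) (w : ℂ) :
    ∃ a b : ℝ, 0 ≤ a ∧ 0 ≤ b ∧ (w = a * x + b * y ∨ w = a * y + b * z ∨ w = a * z + b * x) := by
  obtain rfl : z = -(x + y) := by linear_combination hz
  have hw := exists_coeff h w
  set p := cross w y / cross x y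
  set q := cross x w / cross x y
  rcases le_total 0 p with hp | hp
  · rcases le_total 0 q with hq | hq
    · exact ⟨p, q, hp, hq, Or.inl hw⟩
    · exact ⟨-q, p - q, by linarith, by linarith, Or.inr (Or.inr (by
        rw [hw]; push_cast; ring))⟩
  · rcases le_total p q with hq | hq
    · exact ⟨q - p, -p, by linarith, by linarith, Or.inr (Or.inl (by
        rw [hw]; push_cast; ring))⟩
    · exact ⟨-q, p - q, by linarith, by linarith, Or.inr (Or.inr (by
        rw [hw]; push_cast; ring))⟩

/-- The union of three model curves in the sectors spanned by `x, y, z`. -/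
def tripleCurve (O x y z : ℂ) : Set ℂ :=
  frame O x y '' modelCurve ∪ frame O y z '' modelCurve ∪ frame O z x '' modelCurve

lemma isCompact_tripleCurve (O x y z : ℂ) : IsCompact (tripleCurve O x y z) :=
  ((isCompact_modelCurve.image (continuous_frame _ _ _)).union
    (isCompact_modelCurve.image (continuous_frame _ _ _))).union
    (isCompact_modelCurve.image (continuous_frame _ _ _))

lemma volume_tripleCurve (O x y z : ℂ) : volume (tripleCurve O x y z) = 0 := by
  simp [tripleCurve, volume_frame_image, volume_modelCurve]

lemma center_notMem_frame {O x y : ℂ} (h : cross x y ≠ 0) : O ∉ frame O x y '' modelCurve := by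
  rintro ⟨k, hk, he⟩
  obtain ⟨h1, h2⟩ := coeff_eq_zero h (by simpa [frame] using he)
  have := re_add_im_pos hk
  linarith

lemma mem_frame_image_iff {O x y w : ℂ} {s : ℝ} :
    O + s * w ∈ frame O x y '' modelCurve ↔
      ∃ k ∈ modelCurve, (k.re * x + k.im * y : ℂ) = s * w := by
  simp [frame]

lemma tripleCurve_ray_unique {O x y z : ℂ} (h : cross x y ≠ 0) (hz : x + y + z = 0) (w : ℂ)
    (s s' : ℝ) (hs : 0 < s) (hs' : 0 < s') (h1 : O + s * w ∈ tripleCurve O x y z)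
    (h2 : O + s' * w ∈ tripleCurve O x y z) : s = s' := by
  have hyz : y + z + x = 0 := by linear_combination hz
  have hzx : z + x + y = 0 := by linear_combination hz
  have cyz := cross_rotate hz
  have czx := cross_rotate hyz
  have h' : cross y z ≠ 0 := by rwa [cyz]
  have h'' : cross z x ≠ 0 := by rwa [czx]
  simp only [tripleCurve, mem_union, mem_frame_image_iff] at h1 h2
  rcases h1 with (⟨k, hk, e1⟩ | ⟨k, hk, e1⟩) | ⟨k, hk, e1⟩ <;>
  rcases h2 with (⟨l, hl, e2⟩ | ⟨l, hl, e2⟩) | ⟨l, hl, e2⟩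
  · exact (arc_ray_unique h hk hl hs (by rw [e1, e2]; ring)).symm
  · exact (adjacent_ray_unique h hz hk hl hs' hs (by rw [e1, e2]; ring)).symm
  · exact adjacent_ray_unique h'' hzx hl hk hs hs' (by rw [e1, e2]; ring)
  · exact adjacent_ray_unique h hz hl hk hs hs' (by rw [e1, e2]; ring)
  · exact (arc_ray_unique h' hk hl hs (by rw [e1, e2]; ring)).symm
  · exact (adjacent_ray_unique h' hyz hk hl hs' hs (by rw [e1, e2]; ring)).symm
  · exact (adjacent_ray_unique h'' hzx hk hl hs' hs (by rw [e1, e2]; ring)).symm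
  · exact adjacent_ray_unique h' hyz hl hk hs hs' (by rw [e1, e2]; ring)
  · exact (arc_ray_unique h'' hk hl hs (by rw [e1, e2]; ring)).symm

lemma exists_ray_frame (hc : IsPreconnected modelCurve) {O x y w : ℂ} {a b : ℝ} (ha : 0 ≤ a)
    (hb : 0 ≤ b) (hw : w = a * x + b * y) (hw0 : w ≠ 0) :
    ∃ s : ℝ, 0 < s ∧ O + s * w ∈ frame O x y '' modelCurve := by
  have hab : 0 < a + b := by
    by_contra hn
    have ha0 : a = 0 := by linarith
    have hb0 : b = 0 := by linarith
    exact hw0 (by simp [hw, ha0, hb0])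
  obtain ⟨s, hs, hk⟩ := exists_ray hc ha hb hab
  refine ⟨s, hs, mem_frame_image_iff.mpr ⟨_, hk, ?_⟩⟩
  rw [hw]; push_cast; ring

lemma enclosedRegion_tripleCurve (hc : IsPreconnected modelCurve) {O x y z : ℂ}
    (h : cross x y ≠ 0) (hz : x + y + z = 0) :
    enclosedRegion (tripleCurve O x y z) =
      starHull O (tripleCurve O x y z) \ tripleCurve O x y z := by
  have hyz : y + z + x = 0 := by linear_combination hz
  have cyz := cross_rotate hz
  have czx := cross_rotate hyz
  refine enclosedRegion_eq_starHull_diff (isCompact_tripleCurve O x y z) ?_ ?_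
    (tripleCurve_ray_unique h hz)
  · rintro ((hO | hO) | hO)
    · exact center_notMem_frame h hO
    · exact center_notMem_frame (by rwa [cyz]) hO
    · exact center_notMem_frame (by rwa [czx, cyz]) hO
  · intro w hw
    obtain ⟨a, b, ha, hb, hab | hab | hab⟩ := exists_sector h hz w <;>
      obtain ⟨s, hs, hm⟩ := exists_ray_frame hc (O := O) ha hb hab hw
    · exact ⟨s, hs, Or.inl (Or.inl hm)⟩
    · exact ⟨s, hs, Or.inl (Or.inr hm)⟩
    · exact ⟨s, hs, Or.inr hm⟩

lemma starHull_union (O : ℂ) (K L : Set ℂ) : starHull O (K ∪ L) = starHull O K ∪ starHull O L := by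
  simp only [starHull, prod_union, image_union]

lemma starHull_frame_image (hc : IsPreconnected modelCurve) (O x y : ℂ) :
    starHull O (frame O x y '' modelCurve) = frame O x y '' modelRegion := by
  rw [modelRegion_eq_cone hc, starHull, image_image]
  ext w
  simp only [mem_image, mem_prod, Prod.exists, frame, Complex.smul_re, Complex.smul_im, smul_eq_mul]
  constructor
  · rintro ⟨s, _, ⟨hs, k, hk, rfl⟩, rfl⟩
    exact ⟨s, k, ⟨hs, hk⟩, by push_cast; ring⟩
  · rintro ⟨s, k, ⟨hs, hk⟩, rfl⟩
    exact ⟨s, _, ⟨hs, k, hk, rfl⟩, by push_cast; ring⟩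

/-- Adjacent sectors overlap in a null set. -/
lemma aedisjoint_frame_image {O x y z : ℂ} (h : cross x y ≠ 0) (hz : x + y + z = 0) {s t : Set ℂ}
    (hs : s ⊆ cornerTriangle) (ht : t ⊆ cornerTriangle) :
    AEDisjoint volume (frame O x y '' s) (frame O y z '' t) := by
  refine measure_mono_null (t := frame O x y '' {w : ℂ | 1 * w.re + 0 * w.im = 0}) ?_ ?_
  · rintro _ ⟨⟨k, hk, rfl⟩, ⟨l, hl, he⟩⟩
    obtain rfl : z = -(x + y) := by linear_combination hz
    obtain ⟨h1, -, -⟩ := hs hk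
    obtain ⟨-, h2, -⟩ := ht hl
    obtain ⟨h3, -⟩ := coeff_eq_zero h (a := k.re + l.im) (b := k.im - l.re + l.im) (by
      simp only [frame] at he
      push_cast; linear_combination -he)
    refine ⟨k, ?_, rfl⟩
    show 1 * k.re + 0 * k.im = 0
    linarith
  · rw [volume_frame_image, volume_line (by norm_num), mul_zero]

lemma volume_enclosedRegion_tripleCurve (hc : IsPreconnected modelCurve) {O x y z : ℂ}
    (h : cross x y ≠ 0) (hz : x + y + z = 0) :
    volume (enclosedRegion (tripleCurve O x y z)) =
      3 * (ENNReal.ofReal |cross x y| * volume modelRegion) := by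
  have hyz : y + z + x = 0 := by linear_combination hz
  have hzx : z + x + y = 0 := by linear_combination hz
  have cyz := cross_rotate hz
  have czx := cross_rotate hyz
  have hms : ∀ u v : ℂ, NullMeasurableSet (frame O u v '' modelRegion) volume := fun u v =>
    ((isCompact_modelRegion hc).image (continuous_frame O u v)).measurableSet.nullMeasurableSet
  have hsub := modelRegion_subset
  have d1 := aedisjoint_frame_image (O := O) h hz hsub hsub
  have d2 := aedisjoint_frame_image (O := O) (by rwa [cyz]) hyz hsub hsub
  have d3 := aedisjoint_frame_image (O := O) (by rwa [czx, cyz]) hzx hsub hsub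
  rw [enclosedRegion_tripleCurve hc h hz, measure_sdiff_null (volume_tripleCurve O x y z),
    tripleCurve, starHull_union, starHull_union, starHull_frame_image hc,
    starHull_frame_image hc, starHull_frame_image hc,
    measure_union₀ (hms _ _) (AEDisjoint.union_left d3.symm d2),
    measure_union₀ (hms _ _) d1, volume_frame_image, volume_frame_image, volume_frame_image,
    czx, cyz]
  ring

lemma cornerTriangle_eq_convexHull : cornerTriangle = convexHull ℝ {0, 1, Complex.I} := by
  apply subset_antisymm
  · rintro z ⟨h1, h2, h3⟩
    have hconv := convex_convexHull ℝ ({0, 1, Complex.I} : Set ℂ)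
    have hm : ∀ w ∈ ({0, 1, Complex.I} : Set ℂ), w ∈ convexHull ℝ ({0, 1, Complex.I} : Set ℂ) :=
      fun w hw => subset_convexHull ℝ _ hw
    have := hconv.sum_mem (t := Finset.univ) (w := ![1 - z.re - z.im, z.re, z.im])
      (z := ![0, 1, Complex.I]) (by
        intro i _; fin_cases i
        · simp; linarith
        · simpa using h1
        · simpa using h2) (by simp [Fin.sum_univ_three]; ring) (by
        intro i _; fin_cases i <;> apply hm <;> simp)
    convert this using 1
    apply Complex.ext <;> simp [Fin.sum_univ_three]
  · refine convexHull_min ?_ ?_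
    · rintro z (rfl | rfl | rfl) <;> norm_num [cornerTriangle]
    · rintro u ⟨h1, h2, h3⟩ v ⟨h4, h5, h6⟩ a b ha hb hab
      refine ⟨?_, ?_, ?_⟩
      · simp; positivity
      · simp; positivity
      · simp; nlinarith

lemma volume_convexHull_triple (p x y : ℂ) :
    volume (convexHull ℝ {p, p + x, p + y}) =
      ENNReal.ofReal |cross x y| * volume cornerTriangle := by
  let f : ℂ →ₗ[ℝ] ℂ :=
    { toFun := fun z => z.re * x + z.im * y
      map_add' := fun a b => by simp; ring
      map_smul' := fun c a => by simp; ring }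
  let F : ℂ →ᵃ[ℝ] ℂ := AffineMap.const ℝ ℂ p + f.toAffineMap
  have hF : ⇑F = frame p x y := by
    funext z; simp [F, f, frame]
  rw [← volume_frame_image p, cornerTriangle_eq_convexHull, ← hF, AffineMap.image_convexHull, hF]
  simp [image_insert_eq, frame]

/-! ### Proper triangles -/

variable {C₀ : RoundDisc} {C C₁ C₂ C₃ : GenDisc}

lemma IsSpinor.neg {u : ℂ} (h : IsSpinor C₀ u C) : IsSpinor C₀ (-u) C := by
  cases C with
  | disc D => exact ⟨h.1, by rw [neg_sq]; exact h.2⟩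
  | halfPlane n hn d => exact ⟨h.1, by rw [neg_sq]; exact h.2⟩

lemma dot_neg_left (x y : ℂ) : dot (-x) y = -dot x y := by simp [dot]; ring

lemma dot_neg_right (x y : ℂ) : dot x (-y) = -dot x y := by simp [dot]; ring

/-- An Apollonian curve in terms of spinors of the two circles that form an obtuse angle. -/
lemma ApollonianCurve.exists_frame_of_obtuse (g : ApollonianCurve C₀ C₁ C₂)
    (h12 : ExternallyTangent C₁ C₂) {w w' : ℂ} (hw : IsSpinor C₀ w C₁) (hw' : IsSpinor C₀ w' C₂)
    (hd : dot w w' < 0) :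
    ∃ lam : ℝ, g.source - g.target = lam * (w - w') ∧
      g.image = frame (g.source - lam * w) (lam * w) (lam * w') '' modelCurve := by
  obtain ⟨u, v, lam, hu, hv, huv, he, hi⟩ := g.exists_frame hw.tangent hw'.tangent h12
  -- Passing from the acute pair to the obtuse one flips exactly one sign.
  rcases hw.eq_or_eq_neg hu with rfl | rfl <;> rcases hw'.eq_or_eq_neg hv with rfl | rfl
  · linarith
  · exact ⟨lam, by rw [he]; ring, by rw [hi]; ring_nf⟩
  · exact ⟨-lam, by rw [he]; push_cast; ring, by rw [hi]; push_cast; ring_nf⟩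
  · rw [dot_neg_left, dot_neg_right] at huv; linarith

/-- The coordinates of z in the basis x, y are quotients of cross products, each ±1. -/
lemma eq_combination_of_cross_sq {x y z : ℂ} {c : ℝ} (hc : c ≠ 0) (hxy : cross x y ^ 2 = c ^ 2)
    (hxz : cross x z ^ 2 = c ^ 2) (hzy : cross z y ^ 2 = c ^ 2) :
    (z = x + y ∨ z = -(x + y)) ∨ (z = x - y ∨ z = -(x - y)) := by
  have hne : cross x y ≠ 0 := by
    intro h; rw [h] at hxy; exact hc (by simpa using hxy.symm)
  have hz := exists_coeff hne z
  rw [← hxy] at hxz hzy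
  have e1 : cross x z / cross x y = 1 ∨ cross x z / cross x y = -1 := by
    rcases sq_eq_sq_iff_eq_or_eq_neg.mp hxz with h | h <;> rw [h]
    · left; field_simp
    · right; field_simp
  have e2 : cross z y / cross x y = 1 ∨ cross z y / cross x y = -1 := by
    rcases sq_eq_sq_iff_eq_or_eq_neg.mp hzy with h | h <;> rw [h]
    · left; field_simp
    · right; field_simp
  rcases e1 with e1 | e1 <;> rcases e2 with e2 | e2 <;> rw [e1, e2] at hz
  · left; left; rw [hz]; push_cast; ring
  · right; right; rw [hz]; push_cast; ring
  · right; left; rw [hz]; push_cast; ring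
  · left; right; rw [hz]; push_cast; ring

/-- If `C₀` is the successor of `(C₁, C₂, C₃)`, then the three circles have spinors with
sum zero. -/
lemma exists_spinors_sum_eq_zero (h12 : ExternallyTangent C₁ C₂) (h23 : ExternallyTangent C₂ C₃)
    (h31 : ExternallyTangent C₃ C₁) (h1 : ExternallyTangent (.disc C₀) C₁)
    (h2 : ExternallyTangent (.disc C₀) C₂) (h3 : ExternallyTangent (.disc C₀) C₃)
    (hs : IsSmaller C₀ C₃) :
    ∃ x y z : ℂ, IsSpinor C₀ x C₁ ∧ IsSpinor C₀ y C₂ ∧ IsSpinor C₀ z C₃ ∧ x + y + z = 0 := by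
  have ex : ∀ {C : GenDisc}, ExternallyTangent (.disc C₀) C → ∃ u, IsSpinor C₀ u C := fun h => by
    obtain ⟨ρ, -, hρ⟩ := exists_isSpinor h (a := Complex.arg (centerVec C₀ _)) rfl
    exact ⟨_, hρ⟩
  obtain ⟨x, hx⟩ := ex h1
  obtain ⟨z, hz⟩ := ex h3
  obtain ⟨y, hy, hxy⟩ : ∃ y, IsSpinor C₀ y C₂ ∧ dot x y ≤ 0 := by
    obtain ⟨y, hy⟩ := ex h2
    rcases le_total (dot x y) 0 with h | h
    · exact ⟨y, hy, h⟩
    · exact ⟨-y, hy.neg, by rw [dot_neg_right]; linarith⟩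
  have hr := C₀.radius_pos
  have hsq : ∀ c : ℝ, (C₀.radius * c) ^ 2 = 1 → c ^ 2 = C₀.radius⁻¹ ^ 2 := fun c h => by
    field_simp; linarith
  have cxy := hsq _ (cross_sq_of_tangent hx hy h12)
  have cxz := hsq _ (cross_sq_of_tangent hx hz h31.symm)
  have czy := hsq _ (cross_sq_of_tangent hz hy h23.symm)
  rcases eq_combination_of_cross_sq (inv_ne_zero hr.ne') cxy cxz czy with (h | h) | h
  · exact ⟨x, y, -z, hx, hy, hz.neg, by rw [h]; ring⟩
  · exact ⟨x, y, z, hx, hy, hz, by rw [h]; ring⟩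
  -- For z = ±(x − y) the non-acute angle gives |z|² ≥ |x|² + |y|² ≥ 2/r₀, whereas `C₀` being
  -- smaller than `C₃` gives |z|² < 2/r₀.
  · exfalso
    have hn : Complex.normSq z = Complex.normSq (x + -y) := by
      rcases h with h | h
      · rw [h, sub_eq_add_neg]
      · rw [h, Complex.normSq_neg, sub_eq_add_neg]
    rw [normSq_add_eq, Complex.normSq_neg, dot_neg_right, hz.normSq_eq] at hn
    simp only [IsSmaller, GenDisc.curvature] at hs
    have := hx.inv_radius_le
    have := hy.inv_radius_le
    change C₃.curvature < C₀.radius⁻¹ at hs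
    linarith

lemma dot_neg_of_sum_eq_zero {x y z : ℂ} (hx : IsSpinor C₀ x C₁) (hy : IsSpinor C₀ y C₂)
    (hz : IsSpinor C₀ z C₃) (hsum : x + y + z = 0) (hs : IsSmaller C₀ C₃) : dot x y < 0 := by
  have hn : Complex.normSq z = Complex.normSq (x + y) := by
    rw [← Complex.normSq_neg]; congr 1; linear_combination -hsum
  rw [normSq_add_eq, hz.normSq_eq] at hn
  have := hx.inv_radius_le
  have := hy.inv_radius_le
  change C₃.curvature < C₀.radius⁻¹ at hs
  linarith

lemma frame_image_zero (O : ℂ) : frame O 0 0 '' modelCurve = {O} := by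
  have : frame O 0 0 = fun _ => O := by funext z; simp [frame]
  rw [this, Set.Nonempty.image_const ⟨1, one_mem_modelCurve⟩]

/-- A proper Apollonian triangle has `4 / 7` of the area of the triangle of its vertices. -/
theorem volume_of_isProper (p₁ p₂ p₃ : ℂ)
    (T : Set ℂ) (hT : IsApollonianTriangle C₀ C₁ C₂ C₃ p₁ p₂ p₃ T)
    (hproper : IsProper C₀ C₁ C₂ C₃) :
    volume T = 4 / 7 * volume (convexHull ℝ {p₁, p₂, p₃}) := by
  obtain ⟨h12, h23, h31, h1, h2, h3, g, g', g'', ht'', hs, ht, hs', ht', hs'', rfl⟩ := hT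
  obtain ⟨x, y, z, hx, hy, hz, hsum⟩ :=
    exists_spinors_sum_eq_zero h12 h23 h31 h1 h2 h3 hproper.smaller₃
  have hyz : y + z + x = 0 := by linear_combination hsum
  have hzx : z + x + y = 0 := by linear_combination hsum
  obtain ⟨μ, e, hi⟩ := g.exists_frame_of_obtuse h12 hx hy
    (dot_neg_of_sum_eq_zero hx hy hz hsum hproper.smaller₃)
  obtain ⟨μ', e', hi'⟩ := g'.exists_frame_of_obtuse h23 hy hz
    (dot_neg_of_sum_eq_zero hy hz hx hyz hproper.smaller₁)
  obtain ⟨μ'', e'', hi''⟩ := g''.exists_frame_of_obtuse h31 hz hx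
    (dot_neg_of_sum_eq_zero hz hx hy hzx hproper.smaller₂)
  rw [hs, ht] at e
  rw [hs', ht'] at e'
  rw [hs'', ht''] at e''
  have hne : cross x y ≠ 0 := by
    have := cross_sq_of_tangent hx hy h12
    intro h0; rw [h0] at this; norm_num at this
  obtain rfl : z = -(x + y) := by linear_combination hsum
  -- The chords close up: μ(x − y) + μ'(y − z) + μ''(z − x) = 0 with z = −(x + y), which leaves only
  -- equal factors.
  obtain ⟨c1, c2⟩ := coeff_eq_zero hne (a := μ + μ' - 2 * μ'') (b := -μ + 2 * μ' - μ'') (by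
    push_cast; linear_combination -e - e' - e'')
  obtain rfl : μ' = μ := by linarith
  obtain rfl : μ'' = μ' := by linarith
  have hO' : p₂ - μ'' * y = p₁ - μ'' * x := by linear_combination -e
  have hO'' : p₃ - μ'' * -(x + y) = p₁ - μ'' * x := by linear_combination e''
  have hK : g.image ∪ g'.image ∪ g''.image =
      tripleCurve (p₁ - μ'' * x) (μ'' * x) (μ'' * y) (μ'' * -(x + y)) := by
    rw [hi, hi', hi'', hs, hs', hs'', hO', hO'', tripleCurve]
  have hp2 : p₂ = p₁ + μ'' * (y - x) := by linear_combination -e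
  have hp3 : p₃ = p₁ + μ'' * (-(x + y) - x) := by linear_combination e''
  -- The common corner is the centroid, so each sector triangle has a third of the area.
  have hcross : cross (μ'' * (y - x)) (μ'' * (-(x + y) - x)) = 3 * cross (μ'' * x) (μ'' * y) := by
    simp [cross]; ring
  rw [hK, hp2, hp3, volume_convexHull_triple, hcross]
  by_cases hμ : μ'' = 0
  · have h0 : tripleCurve (p₁ - μ'' * x) (μ'' * x) (μ'' * y) (μ'' * -(x + y)) = {p₁} := by
      simp [tripleCurve, hμ, frame_image_zero]
    rw [h0, enclosedRegion_singleton, hμ]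
    simp [cross]
  have hc0 : cross (μ'' * x) (μ'' * y) ≠ 0 := by
    have : cross (μ'' * x) (μ'' * y) = μ'' ^ 2 * cross x y := by simp [cross]; ring
    rw [this]; positivity
  have hc : IsPreconnected modelCurve := by
    refine isPreconnected_modelCurve_of_frame hc0 (O := g.source - μ'' * x) ?_
    rw [← hi]
    exact isPreconnected_uIcc.image _ g.continuousOn
  rw [volume_enclosedRegion_tripleCurve hc hc0 (by ring), volume_modelRegion hc, abs_mul,
    ENNReal.ofReal_mul (abs_nonneg _), abs_of_pos (by norm_num : (0 : ℝ) < 3)]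
  norm_num
  ring

end Apollonian

theorem lemma6 (C₀ : Apollonian.RoundDisc) (C₁ C₂ C₃ : Apollonian.GenDisc) (p₁ p₂ p₃ : ℂ)
    (T : Set ℂ) (hT : Apollonian.IsApollonianTriangle C₀ C₁ C₂ C₃ p₁ p₂ p₃ T)
    (hproper : Apollonian.IsProper C₀ C₁ C₂ C₃) :
    MeasureTheory.volume T =
      (4 / 7 : ENNReal) * MeasureTheory.volume (convexHull ℝ ({p₁, p₂, p₃} : Set ℂ)) :=
  Apollonian.volume_of_isProper p₁ p₂ p₃ T hT hproper
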